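/- Let $n\ge 1$ and let $\mathbb{H}^n=\mathbb{R}^{2n+1}$ be the Heisenberg group with group law $x\cdot y=\big(x_1+y_1,\dots,x_{2n}+y_{2n},\,x_{2n+1}+y_{2n+1}+\tfrac12\sum_{j=1}^n(x_jy_{n+j}-x_{n+j}y_j)\big)$, horizontal fields $X_j=\partial_{x_j}-\frac{x_{n+j}}{2}\partial_{x_{2n+1}}$, $X_{n+j}=\partial_{x_{n+j}}+\frac{x_j}{2}\partial_{x_{2n+1}}$ ($1\le j\le n$), declared orthonormal for the norm $|\cdot|_H$ on their span, Lebesgue measure, and homogeneous dimension $N=2n+2$. A curve is horizontal if it is absolutely continuous and its velocity is in the span of $X_1,\dots,X_{2n}$ at almost every time; $l_H(\sigma)=\int|\dot\sigma|_H\,dt$ is its length, and $d_{CC}(x,y)$ is the infimum of the lengths of the horizontal curves from $x$ to $y$. Let $\Omega\subset\mathbb{H}^n$ be a nonempty bounded connected open set. For $x,y\in\overline\Omega$ let $H^{x,y}$ be the set of horizontal curves $\sigma:[0,1]\to\overline\Omega$ with $\sigma(0)=x$, $\sigma(1)=y$. For $\phi\in C(\overline\Omega)$, $\phi\ge 0$,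 put $$L_\phi(\sigma)=\sup\Big\{\sum_{i=0}^{m-1}\Big(\inf_{[t_i,t_{i+1}]}\phi\circ\sigma\Big)\,d_{CC}(\sigma(t_i),\sigma(t_{i+1}))\;:\;0=t_0\le t_1\le\dots\le t_m=1\Big\},\qquad c_\phi(x,y)=\inf_{\sigma\in H^{x,y}}L_\phi(\sigma).$$ Assume that $\partial\Omega$ is regular in the following sense; for every $x_0\in\partial\Omega$: (a) for every $\varepsilon>0$, every point $x\in\overline\Omega$ sufficiently close to $x_0$ is the endpoint of some $\sigma\in H^{x_0,x}$ with $l_H(\sigma)<\varepsilon$; (b) there are a neighbourhood $U$ of $x_0$ and points $h\in\mathbb{H}^n$ arbitrarily close to $0$ with $h\cdot(U\cap\overline\Omega)\subset\Omega$. (Both conditions hold if $\partial\Omega$ is smooth.) Let $1<p<\frac{N}{N-1}$ and $p'=\frac{p}{p-1}$. For a function $\phi$ on $\Omega$ let $\mathcal{C}(\phi)$ be the set of all limits $c=\lim_{k\to\infty}c_{\phi_k}$ in $C(\overline\Omega\times\overline\Omega)$ (uniform limits of finite continuous functions), where $\phi_k\in C(\overline\Omega)$, $\phi_k\ge 0$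 and $\phi_k\to\phi$ in $L^{p'}(\Omega)$. **Proposition.** For every $\phi\in C(\overline\Omega)$ with $\phi\ge 0$ and all $x,y\in\overline\Omega$, $$c_\phi(x,y)=\sup\{c(x,y)\;:\;c\in\mathcal{C}(\phi)\}.$$ The right-hand side makes sense for every nonnegative $\phi\in L^{p'}(\Omega)$, and is taken as the definition of $c_\phi$ for such $\phi$. -/

import Mathlib

open MeasureTheory Set Filter Topology
open scoped ENNReal NNReal

/-- The Heisenberg group in canonical coordinates of the first kind: the point
`(x, y, z)` has horizontal coordinates `x_1, …, x_n` and `x_{n+1}, …, x_{2n}` (here `y`) and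
vertical coordinate `x_{2n+1}` (here `z`). Its topology is that of `ℝ^{2n+1}` and its `volume` is
the Lebesgue measure, which is the Haar measure of the group. -/
abbrev Heis (n : ℕ) : Type := (Fin n → ℝ) × (Fin n → ℝ) × ℝ

namespace Heis

variable {n : ℕ}

/-- The group law of the Heisenberg group. (The multiplication which the product type inherits from
`ℝ` is never used.) -/
noncomputable def mul (p q : Heis n) : Heis n :=
  (p.1 + q.1, p.2.1 + q.2.1,
    p.2.2 + q.2.2 + (1 / 2) * ∑ j, (p.1 j * q.2.1 j - p.2.1 j * q.1 j))

/-- The left-invariant vector field `X_j = ∂_{x_j} - (x_{n+j} / 2) ∂_{x_{2n+1}}`. -/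
noncomputable def fieldX (j : Fin n) (q : Heis n) : Heis n :=
  (Pi.single j 1, 0, -(q.2.1 j) / 2)

/-- The left-invariant vector field `X_{n+j} = ∂_{x_{n+j}} + (x_j / 2) ∂_{x_{2n+1}}`. -/
noncomputable def fieldY (j : Fin n) (q : Heis n) : Heis n :=
  (0, Pi.single j 1, q.1 j / 2)

/-- The fibre at `q` of the horizontal bundle. -/
noncomputable def horizontalSpace (q : Heis n) : Submodule ℝ (Heis n) :=
  Submodule.span ℝ (range (fun j => fieldX j q) ∪ range (fun j => fieldY j q))

/-- The norm `|v|_H` of a horizontal vector `v`, for which the `X_j`, `X_{n+j}` are orthonormal: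
the coefficients of `v` in this basis are its first `2n` coordinates, see `horNorm_combination`. -/
noncomputable def horNorm (v : Heis n) : ℝ :=
  √(∑ j, (v.1 j) ^ 2 + ∑ j, (v.2.1 j) ^ 2)

theorem combination_eq (q : Heis n) (a b : Fin n → ℝ) :
    ∑ j, a j • fieldX j q + ∑ j, b j • fieldY j q =
      (a, b, (1 / 2) * ∑ j, (q.1 j * b j - q.2.1 j * a j)) := by
  refine Prod.ext ?_ (Prod.ext ?_ ?_)
  · ext i
    simp [fieldX, fieldY, Prod.fst_sum, Finset.sum_apply, Pi.single_apply]
  · ext i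
    simp [fieldX, fieldY, Prod.fst_sum, Prod.snd_sum, Finset.sum_apply, Pi.single_apply]
  · simp only [fieldX, fieldY, Prod.snd_add, Prod.snd_sum, Prod.smul_snd, smul_eq_mul,
      Finset.mul_sum]
    rw [← Finset.sum_add_distrib]
    exact Finset.sum_congr rfl fun j _ => by ring

theorem horNorm_combination (q : Heis n) (a b : Fin n → ℝ) :
    horNorm (∑ j, a j • fieldX j q + ∑ j, b j • fieldY j q) =
      √(∑ j, (a j) ^ 2 + ∑ j, (b j) ^ 2) := by
  rw [combination_eq]; rfl

theorem mem_horizontalSpace (q v : Heis n) :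
    v ∈ horizontalSpace q ↔ v.2.2 = (1 / 2) * ∑ j, (q.1 j * v.2.1 j - q.2.1 j * v.1 j) := by
  constructor
  · intro h
    refine Submodule.span_induction (p := fun v _ =>
      v.2.2 = (1 / 2) * ∑ j, (q.1 j * v.2.1 j - q.2.1 j * v.1 j)) ?_ ?_ ?_ ?_ h
    · rintro _ (⟨j, rfl⟩ | ⟨j, rfl⟩)
      · simp [fieldX, Pi.single_apply]; ring
      · simp [fieldY, Pi.single_apply]; ring
    · simp
    · intro x y _ _ hx hy
      simp only [Prod.snd_add, Prod.fst_add, Pi.add_apply, hx, hy]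
      rw [← mul_add, ← Finset.sum_add_distrib]
      congr 1
      exact Finset.sum_congr rfl fun j _ => by ring
    · intro a x _ hx
      simp only [Prod.smul_snd, Prod.smul_fst, Pi.smul_apply, smul_eq_mul, hx, Finset.mul_sum]
      exact Finset.sum_congr rfl fun j _ => by ring
  · intro h
    have hv : v = ∑ j, v.1 j • fieldX j q + ∑ j, v.2.1 j • fieldY j q := by
      rw [combination_eq, ← h]
    rw [hv]
    exact add_mem
      (sum_mem fun j _ => Submodule.smul_mem _ _ (Submodule.subset_span (Or.inl ⟨j, rfl⟩)))
      (sum_mem fun j _ => Submodule.smul_mem _ _ (Submodule.subset_span (Or.inr ⟨j, rfl⟩)))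

/-- `σ` restricts to an absolutely continuous horizontal curve on `[a, b]`. -/
def IsHorizontal (σ : ℝ → Heis n) (a b : ℝ) : Prop :=
  AbsolutelyContinuousOnInterval σ a b ∧
    ∀ᵐ t ∂(volume.restrict (Icc a b)), deriv σ t ∈ horizontalSpace (σ t)

/-- The horizontal length `∫_a^b |σ'(t)|_H dt`. -/
noncomputable def horLength (σ : ℝ → Heis n) (a b : ℝ) : ℝ≥0∞ :=
  ∫⁻ t in Icc a b, ENNReal.ofReal (horNorm (deriv σ t))

/-- The Carnot–Carathéodory distance. -/
noncomputable def ccDist (p q : Heis n) : ℝ≥0∞ :=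
  ⨅ (a : ℝ) (b : ℝ) (σ : ℝ → Heis n)
    (_ : a ≤ b ∧ IsHorizontal σ a b ∧ σ a = p ∧ σ b = q), horLength σ a b

/-- The set `H^{x,y}` of horizontal curves `[0, 1] → closure Ω` from `x` to `y`. -/
def curves (Ω : Set (Heis n)) (x y : Heis n) : Set (ℝ → Heis n) :=
  {σ | IsHorizontal σ 0 1 ∧ (∀ t ∈ Icc (0 : ℝ) 1, σ t ∈ closure Ω) ∧ σ 0 = x ∧ σ 1 = y}

/-- The weighted length `L_φ(σ)` of a curve `σ` on `[0, 1]`, for a weight `φ ≥ 0`: the supremum, over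
all partitions `0 = t_0 ≤ t_1 ≤ … ≤ t_m = 1`, of
`∑ i, (inf_{[t_i, t_{i+1}]} φ ∘ σ) * d_CC (σ (t_i), σ (t_{i+1}))`. -/
noncomputable def weightedLength (φ : Heis n → ℝ) (σ : ℝ → Heis n) : ℝ≥0∞ :=
  ⨆ (m : ℕ) (t : ℕ → ℝ) (_ : Monotone t ∧ t 0 = 0 ∧ t m = 1),
    ∑ i ∈ Finset.range m,
      (⨅ s ∈ Icc (t i) (t (i + 1)), ENNReal.ofReal (φ (σ s))) * ccDist (σ (t i)) (σ (t (i + 1)))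

/-- `c_φ(x, y) = inf {L_φ(σ) : σ ∈ H^{x,y}}`, with value `∞` if there is no such curve. -/
noncomputable def cost (Ω : Set (Heis n)) (φ : Heis n → ℝ) (x y : Heis n) : ℝ≥0∞ :=
  ⨅ σ ∈ curves Ω x y, weightedLength φ σ

/-- The restriction of `φ` to `closure Ω` is continuous and nonnegative. (Functions on `closure Ω`
are represented by functions on the whole space, whose values elsewhere are irrelevant.) -/
def IsWeight (Ω : Set (Heis n)) (φ : Heis n → ℝ) : Prop :=
  ContinuousOn φ (closure Ω) ∧ ∀ x ∈ closure Ω, 0 ≤ φ x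

/-- The set `𝒞(φ)` of all limits `c`, in the space of continuous functions on
`closure Ω × closure Ω` (with the topology of uniform convergence), of sequences `c_{φ_k}` of finite
continuous costs, where `φ_k ≥ 0` is continuous on `closure Ω` and `φ_k → φ` in `L^q(Ω)`. -/
def limitCosts (Ω : Set (Heis n)) (q : ℝ≥0∞) (φ : Heis n → ℝ) :
    Set C(closure Ω × closure Ω, ℝ≥0) :=
  {c | ∃ ψ : ℕ → Heis n → ℝ, (∀ k, IsWeight Ω (ψ k)) ∧
    Tendsto (fun k => eLpNorm (fun x => ψ k x - φ x) q (volume.restrict Ω)) atTop (𝓝 0) ∧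
    ∃ C : ℕ → C(closure Ω × closure Ω, ℝ≥0),
      (∀ k z, (C k z : ℝ≥0∞) = cost Ω (ψ k) z.1 z.2) ∧ Tendsto C atTop (𝓝 c)}

/-- The cost associated with a general nonnegative `φ` in `L^q(Ω)`:
the supremum of `c(x, y)` over all `c` in `𝒞(φ)`. -/
noncomputable def generalCost (Ω : Set (Heis n)) (q : ℝ≥0∞) (φ : Heis n → ℝ)
    (x y : closure Ω) : ℝ≥0∞ :=
  ⨆ c ∈ limitCosts Ω q φ, (c (x, y) : ℝ≥0∞)

/-- Boundary points are joined to the nearby points of `closure Ω` by short horizontal curves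
in `closure Ω`. -/
def AccessibleBoundary (Ω : Set (Heis n)) : Prop :=
  ∀ x₀ ∈ frontier Ω, ∀ ε : ℝ, 0 < ε →
    ∀ᶠ x in 𝓝[closure Ω] x₀, ∃ σ ∈ curves Ω x₀ x, horLength σ 0 1 < ENNReal.ofReal ε

/-- Near each boundary point, arbitrarily small left translations push `closure Ω` into `Ω`
(a segment property for the group law; Lipschitz boundaries have it). -/
def InwardTranslations (Ω : Set (Heis n)) : Prop :=
  ∀ x₀ ∈ frontier Ω, ∃ U ∈ 𝓝 x₀, ∃ᶠ h in 𝓝 (0 : Heis n), ∀ q ∈ U ∩ closure Ω, mul h q ∈ Ω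

end Heis

/-! The weighted length of a horizontal curve is compared with the line integral `∫ φ(σ) |σ'|_H dt`:
partition sums are at most the integral, and Fatou's lemma gives the converse, so `c_φ` is an
infimum of line integrals (`cost_eq_iInf_lineIntegral`). This form is additive under concatenation
and behaves well under left translations, which preserve horizontality and speed.

`c_φ ≤ sup`: the constant sequence `φ_k = φ` is admissible as soon as `c_φ` is finite and
continuous. By the triangle inequality this reduces to `c_φ(x₀, x) → 0` as `x → x₀`: inside `Ω`
short explicit curves reach every nearby point, and at the boundary accessibility is used.
Connectedness then gives finiteness.

`sup ≤ c_φ`: let `c = lim c_{ψ_k}` and let `σ` be a curve. `L^{p'}` convergence says nothing about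
`ψ_k` on the null set traced by `σ`, so `σ` is moved by left translations `h` ranging over a small
ball. Lebesgue measure being right-invariant, the average over `h` of `∫ |ψ_k - φ|(h·σ) |σ'|_H` is
at most `‖ψ_k - φ‖₁` times the length of `σ` over the volume of the ball, so some `h` makes it small
(`exists_translate_lintegral_le`). Uniform convergence and continuity of `c` absorb the displacement
of the endpoints. Inward translations keep short pieces of `σ` inside `Ω`; the pieces are added up
with the triangle inequality for `c`. -/

/-! ### Absolutely continuous curves -/

/-- An absolutely continuous function composed with a monotone or antitone Lipschitz map is
absolutely continuous. -/
theorem AbsolutelyContinuousOnInterval.comp_lipschitz {X : Type*} [PseudoMetricSpace X]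
    {f : ℝ → X} {g : ℝ → ℝ} {a b c d : ℝ} {K : ℝ≥0} (hf : AbsolutelyContinuousOnInterval f a b)
    (hg : Monotone g ∨ Antitone g) (hK : LipschitzWith K g)
    (hm : MapsTo g (uIcc c d) (uIcc a b)) :
    AbsolutelyContinuousOnInterval (f ∘ g) c d := by
  rw [absolutelyContinuousOnInterval_iff] at hf ⊢
  intro ε hε
  obtain ⟨δ, hδ, h⟩ := hf ε hε
  -- `K + 1` rather than `K`, since `K` may vanish.
  refine ⟨δ / (K + 1), by positivity, fun E hE hsum => ?_⟩
  refine h (E.1, fun i => (g (E.2 i).1, g (E.2 i).2)) ⟨fun i hi => ?_, fun i hi j hj hij => ?_⟩ ?_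
  · exact ⟨hm (hE.1 i hi).1, hm (hE.1 i hi).2⟩
  · have h1 : Disjoint (uIoc (E.2 i).1 (E.2 i).2) (uIoc (E.2 j).1 (E.2 j).2) := hE.2 hi hj hij
    change Disjoint (uIoc _ _) (uIoc _ _)
    -- Disjointness of half-open intervals becomes an inequality between a `min` of right ends and a
    -- `max` of left ends, which monotone maps respect.
    rw [uIoc, uIoc, Ioc_disjoint_Ioc] at h1 ⊢
    rcases hg with hg | hg
    · rw [← hg.map_min, ← hg.map_max, ← hg.map_min, ← hg.map_max, ← hg.map_max, ← hg.map_min]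
      exact hg h1
    · rw [← hg.map_min, ← hg.map_max, ← hg.map_min, ← hg.map_max, ← hg.map_max, ← hg.map_min]
      rcases min_le_iff.1 h1 with h2 | h2 <;> rcases le_max_iff.1 h2 with h3 | h3 <;>
        exact hg (by simp only [le_min_iff, max_le_iff, min_le_iff, le_max_iff] at *; grind)
  · calc ∑ i ∈ Finset.range E.1, dist (g (E.2 i).1) (g (E.2 i).2)
        ≤ ∑ i ∈ Finset.range E.1, (K + 1) * dist (E.2 i).1 (E.2 i).2 := by
          refine Finset.sum_le_sum fun i _ => (hK.dist_le_mul _ _).trans ?_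
          gcongr; simp
      _ < δ := by
          rw [← Finset.mul_sum]
          rwa [lt_div_iff₀' (by positivity)] at hsum

theorem LipschitzWith.comp_absolutelyContinuousOnInterval {X Y : Type*} [PseudoMetricSpace X]
    [PseudoMetricSpace Y] {f : ℝ → X} {g : X → Y} {a b : ℝ} {K : ℝ≥0} (hg : LipschitzWith K g)
    (hf : AbsolutelyContinuousOnInterval f a b) : AbsolutelyContinuousOnInterval (g ∘ f) a b := by
  refine squeeze_zero (fun E => Finset.sum_nonneg fun i _ => dist_nonneg) (fun E => ?_)
    (by simpa using Tendsto.const_mul (K : ℝ) hf)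
  rw [Finset.mul_sum]
  exact Finset.sum_le_sum fun i _ => hg.dist_le_mul _ _

theorem AbsolutelyContinuousOnInterval.ae_differentiableAt' {V : Type*} [NormedAddCommGroup V]
    [NormedSpace ℝ V] [FiniteDimensional ℝ V] {f : ℝ → V} {a b : ℝ} (hab : a ≤ b)
    (hf : AbsolutelyContinuousOnInterval f a b) :
    ∀ᵐ t ∂(volume.restrict (Icc a b)), DifferentiableAt ℝ f t := by
  rw [ae_restrict_iff' measurableSet_Icc, ← uIcc_of_le hab]
  exact hf.boundedVariationOn.ae_differentiableAt_of_mem_uIcc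

theorem ae_restrict_Icc_of_forall_Ioo {a b : ℝ} {P : ℝ → Prop} (h : ∀ t ∈ Ioo a b, P t) :
    ∀ᵐ t ∂(volume.restrict (Icc a b)), P t := by
  rw [← restrict_Ioo_eq_restrict_Icc]
  exact (ae_restrict_iff' measurableSet_Ioo).2 (ae_of_all _ h)

namespace Heis

variable {n : ℕ}

/-! ### Horizontal speed and line integrals -/

/-- The projection onto the horizontal coordinates. -/
noncomputable def hor (n : ℕ) : Heis n →L[ℝ] EuclideanSpace ℝ (Fin n ⊕ Fin n) :=
  LinearMap.toContinuousLinearMap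
    { toFun := fun v => WithLp.toLp 2 (Sum.elim v.1 v.2.1)
      map_add' := fun v w => by ext (i | i) <;> simp
      map_smul' := fun c v => by ext (i | i) <;> simp }

theorem hor_inl (v : Heis n) (i : Fin n) : hor n v (Sum.inl i) = v.1 i := rfl

theorem hor_inr (v : Heis n) (i : Fin n) : hor n v (Sum.inr i) = v.2.1 i := rfl

theorem horNorm_eq (v : Heis n) : horNorm v = ‖hor n v‖ := by
  rw [horNorm, EuclideanSpace.norm_eq, Fintype.sum_sum_type]
  simp [hor_inl, hor_inr]

/-- The speed of a curve, for the norm of the horizontal bundle. -/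
noncomputable def speed (σ : ℝ → Heis n) (t : ℝ) : ℝ≥0∞ := ENNReal.ofReal (horNorm (deriv σ t))

theorem measurable_speed (σ : ℝ → Heis n) : Measurable (speed σ) := by
  unfold speed
  simp only [horNorm_eq]
  exact (ENNReal.measurable_ofReal.comp ((hor n).continuous.norm.measurable.comp
    (measurable_deriv σ)))

theorem horLength_eq (σ : ℝ → Heis n) (a b : ℝ) :
    horLength σ a b = ∫⁻ t in Icc a b, speed σ t := rfl

/-- The integral of a weight along a curve. -/
noncomputable def lineIntegral (φ : Heis n → ℝ) (σ : ℝ → Heis n) (a b : ℝ) : ℝ≥0∞ :=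
  ∫⁻ t in Icc a b, ENNReal.ofReal (φ (σ t)) * speed σ t

theorem deriv_eqOn_Ioo {σ τ : ℝ → Heis n} {a b : ℝ} (h : EqOn σ τ (Icc a b)) :
    EqOn (deriv σ) (deriv τ) (Ioo a b) := fun t ht =>
  Filter.EventuallyEq.deriv_eq <| by
    filter_upwards [Ioo_mem_nhds ht.1 ht.2] with s hs using h (Ioo_subset_Icc_self hs)

theorem lineIntegral_congr {φ : Heis n → ℝ} {σ τ : ℝ → Heis n} {a b : ℝ}
    (h : EqOn σ τ (Icc a b)) : lineIntegral φ σ a b = lineIntegral φ τ a b := by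
  refine lintegral_congr_ae (ae_restrict_Icc_of_forall_Ioo fun t ht => ?_)
  simp only [speed]
  rw [h (Ioo_subset_Icc_self ht), deriv_eqOn_Ioo h ht]

theorem lintegral_Icc_add {a b c : ℝ} (hab : a ≤ b) (hbc : b ≤ c) (f : ℝ → ℝ≥0∞) :
    ∫⁻ t in Icc a c, f t = (∫⁻ t in Icc a b, f t) + ∫⁻ t in Icc b c, f t := by
  rw [← restrict_Ioc_eq_restrict_Icc, ← restrict_Ioc_eq_restrict_Icc,
    ← restrict_Ioc_eq_restrict_Icc, ← Ioc_union_Ioc_eq_Ioc hab hbc,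
    lintegral_union measurableSet_Ioc (Ioc_disjoint_Ioc_of_le le_rfl)]

theorem lineIntegral_add (φ : Heis n → ℝ) (σ : ℝ → Heis n) {a b c : ℝ} (hab : a ≤ b)
    (hbc : b ≤ c) :
    lineIntegral φ σ a c = lineIntegral φ σ a b + lineIntegral φ σ b c :=
  lintegral_Icc_add hab hbc _

theorem lineIntegral_comp_add_right (φ : Heis n → ℝ) (σ : ℝ → Heis n) (a b d : ℝ) :
    lineIntegral φ (fun t => σ (t + d)) (a - d) (b - d) = lineIntegral φ σ a b := by
  have h := (measurePreserving_add_right volume d).setLIntegral_comp_preimage_emb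
    (measurableEmbedding_addRight d) (fun t => ENNReal.ofReal (φ (σ t)) * speed σ t) (Icc a b)
  rw [preimage_add_const_Icc] at h
  rw [lineIntegral, lineIntegral, ← h]
  simp only [speed, deriv_comp_add_const]

theorem lineIntegral_comp_neg (φ : Heis n → ℝ) (σ : ℝ → Heis n) (a b : ℝ) :
    lineIntegral φ (fun t => σ (-t)) (-b) (-a) = lineIntegral φ σ a b := by
  have h := (Measure.measurePreserving_neg (volume : Measure ℝ)).setLIntegral_comp_preimage_emb
    (MeasurableEquiv.neg ℝ).measurableEmbedding
    (fun t => ENNReal.ofReal (φ (σ t)) * speed σ t) (Icc a b)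
  rw [show (Neg.neg ⁻¹' Icc a b : Set ℝ) = Icc (-b) (-a) by simp] at h
  rw [lineIntegral, lineIntegral, ← h]
  simp only [speed, deriv_comp_neg, horNorm_eq, map_neg, norm_neg]

/-! ### Operations on horizontal curves and bounds on their length -/

theorem IsHorizontal.continuousOn {σ : ℝ → Heis n} {a b : ℝ} (hab : a ≤ b)
    (hσ : IsHorizontal σ a b) : ContinuousOn σ (Icc a b) := by
  simpa [uIcc_of_le hab] using hσ.1.continuousOn

theorem IsHorizontal.mono {σ : ℝ → Heis n} {a b c d : ℝ} (hσ : IsHorizontal σ a b)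
    (hac : a ≤ c) (hcd : c ≤ d) (hdb : d ≤ b) : IsHorizontal σ c d := by
  have h : Icc c d ⊆ Icc a b := Icc_subset_Icc hac hdb
  refine ⟨hσ.1.mono ?_, ae_restrict_of_ae_restrict_of_subset h hσ.2⟩
  rwa [uIcc_of_le hcd, uIcc_of_le (hac.trans (hcd.trans hdb))]

theorem IsHorizontal.comp_affine {σ : ℝ → Heis n} {a b c d k e : ℝ} (hab : a ≤ b) (hcd : c ≤ d)
    (hσ : IsHorizontal σ a b) (hm : MapsTo (fun t => k * t + e) (Icc c d) (Icc a b)) :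
    IsHorizontal (fun t => σ (k * t + e)) c d := by
  constructor
  · refine AbsolutelyContinuousOnInterval.comp_lipschitz (g := fun t => k * t + e) (K := ‖k‖₊)
      hσ.1 ?_ ?_ ?_
    · rcases le_total 0 k with hk | hk
      · exact Or.inl fun s t hst => by dsimp only; gcongr
      · exact Or.inr fun s t hst => by
          dsimp only; linarith [mul_le_mul_of_nonpos_left hst hk]
    · refine LipschitzWith.of_dist_le_mul fun s t => ?_
      simp [Real.dist_eq, ← mul_sub, abs_mul]
    · rwa [uIcc_of_le hab, uIcc_of_le hcd]
  · have hd : ∀ t, deriv (fun t => σ (k * t + e)) t = k • deriv σ (k * t + e) := fun t => by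
      have := deriv_comp_mul_left k (fun s => σ (s + e)) t
      simpa [deriv_comp_add_const] using this
    simp only [hd]
    rcases eq_or_ne k 0 with rfl | hk
    · simp
    · have hq : Measure.QuasiMeasurePreserving (fun t : ℝ => k * t + e) volume volume := by
        refine (measurePreserving_add_right volume e).quasiMeasurePreserving.comp
          (g := fun t => t + e) ⟨measurable_const_mul k, ?_⟩
        rw [Real.map_volume_mul_left hk]
        exact Measure.smul_absolutelyContinuous
      have h := hσ.2
      rw [ae_restrict_iff' measurableSet_Icc] at h ⊢
      filter_upwards [hq.ae h] with t ht htc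
      exact Submodule.smul_mem _ _ (ht (hm htc))

theorem IsHorizontal.glue {σ τ : ℝ → Heis n} {a b c : ℝ} (hab : a ≤ b) (hbc : b ≤ c)
    (hσ : IsHorizontal σ a b) (hτ : IsHorizontal τ b c) (h : σ b = τ b) :
    ∃ ρ, IsHorizontal ρ a c ∧ EqOn ρ σ (Icc a b) ∧ EqOn ρ τ (Icc b c) := by
  -- A closed formula for the concatenation, without case distinction: absolute continuity follows
  -- from that of sums and of Lipschitz monotone reparametrizations.
  have h1 : EqOn (fun t => σ (min t b) + τ (max t b) - σ b) σ (Icc a b) := fun t ht => by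
    simp [ht.2, h]
  have h2 : EqOn (fun t => σ (min t b) + τ (max t b) - σ b) τ (Icc b c) := fun t ht => by
    simp [ht.1]
  refine ⟨_, ⟨?_, ?_⟩, h1, h2⟩
  · refine AbsolutelyContinuousOnInterval.sub (g := fun _ => σ b)
      (AbsolutelyContinuousOnInterval.add
      (hσ.1.comp_lipschitz (g := fun t => min t b) (K := 1) (Or.inl ?_) ?_ ?_)
      (hτ.1.comp_lipschitz (g := fun t => max t b) (K := 1) (Or.inl ?_) ?_ ?_)) ?_
    · exact fun s t hst => min_le_min_right _ hst
    · exact LipschitzWith.id.min_const b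
    · rw [uIcc_of_le hab, uIcc_of_le (hab.trans hbc)]
      exact fun t ht => ⟨le_min ht.1 hab, min_le_right _ _⟩
    · exact fun s t hst => max_le_max_right _ hst
    · exact LipschitzWith.id.max_const b
    · rw [uIcc_of_le hbc, uIcc_of_le (hab.trans hbc)]
      exact fun t ht => ⟨le_max_right _ _, max_le ht.2 hbc⟩
    · exact (LipschitzWith.const (σ b)).lipschitzOnWith.absolutelyContinuousOnInterval
  · rw [← Icc_union_Icc_eq_Icc hab hbc, ae_restrict_union_iff]
    constructor
    · filter_upwards [hσ.2, ae_restrict_Icc_of_forall_Ioo (deriv_eqOn_Ioo h1),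
        ae_restrict_mem measurableSet_Icc] with t h3 h4 h5
      have h6 := h1 h5
      dsimp only at h6
      rwa [h4, h6]
    · filter_upwards [hτ.2, ae_restrict_Icc_of_forall_Ioo (deriv_eqOn_Ioo h2),
        ae_restrict_mem measurableSet_Icc] with t h3 h4 h5
      have h6 := h2 h5
      dsimp only at h6
      rwa [h4, h6]

/-- The speed is at most the sum of the absolute derivatives of the horizontal coordinates, each
integrable because the coordinate is a scalar absolutely continuous function. -/
theorem IsHorizontal.horLength_ne_top {σ : ℝ → Heis n} {a b : ℝ} (hab : a ≤ b)
    (hσ : IsHorizontal σ a b) : horLength σ a b ≠ ∞ := by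
  have hi : ∀ i, IntegrableOn (fun t => ‖hor n (deriv σ t) i‖) (Icc a b) := fun i => by
    have hL := ((EuclideanSpace.proj i).comp (hor n)).lipschitz
    have h1 := (hL.comp_absolutelyContinuousOnInterval hσ.1).intervalIntegrable_deriv
    rw [intervalIntegrable_iff_integrableOn_Icc_of_le hab] at h1
    refine h1.norm.congr ?_
    filter_upwards [hσ.1.ae_differentiableAt' hab] with t ht
    have := (((EuclideanSpace.proj i).comp (hor n)).hasFDerivAt (x := σ t)).comp_hasDerivAt t
      ht.hasDerivAt
    rw [this.deriv]; rfl
  have hs : IntegrableOn (fun t => ∑ i, ‖hor n (deriv σ t) i‖) (Icc a b) :=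
    integrable_finsetSum _ fun i _ => hi i
  refine ne_top_of_le_ne_top hs.2.ne (lintegral_mono fun t => ?_)
  rw [horNorm_eq, ← ofReal_norm]
  refine ENNReal.ofReal_le_ofReal ?_
  rw [Real.norm_of_nonneg (Finset.sum_nonneg fun i _ => norm_nonneg _), EuclideanSpace.norm_eq]
  rw [Real.sqrt_le_left (Finset.sum_nonneg fun i _ => norm_nonneg _)]
  exact Finset.sum_sq_le_sq_sum_of_nonneg fun i _ => norm_nonneg _

/-- The fundamental theorem of calculus is applied to the scalar function `⟨D, hor σ⟩`, where `D` is
the horizontal displacement; Cauchy–Schwarz and division by `‖D‖` conclude. -/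
theorem IsHorizontal.norm_hor_sub_le {σ : ℝ → Heis n} {a b : ℝ} (hab : a ≤ b)
    (hσ : IsHorizontal σ a b) :
    ENNReal.ofReal ‖hor n (σ b - σ a)‖ ≤ horLength σ a b := by
  set D := hor n (σ b - σ a) with hD
  rcases eq_or_ne D 0 with h0 | h0
  · simp [h0]
  set ℓ : Heis n →L[ℝ] ℝ := (innerSL ℝ D).comp (hor n) with hℓ
  have h1 := ℓ.lipschitz.comp_absolutelyContinuousOnInterval hσ.1
  have h2 := h1.integral_deriv_eq_sub
  have hder : ∀ᵐ t ∂(volume.restrict (Icc a b)), ‖deriv (ℓ ∘ σ) t‖ₑ ≤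
      ENNReal.ofReal ‖D‖ * speed σ t := by
    filter_upwards [hσ.1.ae_differentiableAt' hab] with t ht
    rw [(ℓ.hasFDerivAt.comp_hasDerivAt t ht.hasDerivAt).deriv, speed, horNorm_eq,
      ← ENNReal.ofReal_mul (norm_nonneg _), ← ofReal_norm]
    exact ENNReal.ofReal_le_ofReal (norm_inner_le_norm (𝕜 := ℝ) D (hor n (deriv σ t)))
  have h3 : ENNReal.ofReal ‖D‖ * ENNReal.ofReal ‖D‖ ≤ ENNReal.ofReal ‖D‖ * horLength σ a b := by
    calc ENNReal.ofReal ‖D‖ * ENNReal.ofReal ‖D‖ = ‖(ℓ ∘ σ) b - (ℓ ∘ σ) a‖ₑ := by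
          rw [← ofReal_norm, ← ENNReal.ofReal_mul (norm_nonneg _)]
          congr 1
          rw [Function.comp_apply, Function.comp_apply, ← map_sub, hℓ,
            ContinuousLinearMap.comp_apply, ← hD, innerSL_apply_apply,
            real_inner_self_eq_norm_mul_norm]
          simp
      _ ≤ ∫⁻ t in Icc a b, ‖deriv (ℓ ∘ σ) t‖ₑ := by
          rw [← h2, intervalIntegral.integral_of_le hab, ← restrict_Ioc_eq_restrict_Icc]
          exact enorm_integral_le_lintegral_enorm _
      _ ≤ ∫⁻ t in Icc a b, ENNReal.ofReal ‖D‖ * speed σ t := lintegral_mono_ae hder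
      _ = _ := by rw [lintegral_const_mul _ (measurable_speed σ), horLength_eq]
  rwa [ENNReal.mul_le_mul_iff_right (by simpa using h0) ENNReal.ofReal_ne_top] at h3

theorem norm_hor_sub_le_ccDist (p q : Heis n) :
    ENNReal.ofReal ‖hor n (q - p)‖ ≤ ccDist p q := by
  refine le_iInf fun a => le_iInf fun b => le_iInf fun σ => le_iInf fun h => ?_
  obtain ⟨hab, hσ, rfl, rfl⟩ := h
  exact hσ.norm_hor_sub_le hab

theorem IsHorizontal.ccDist_le {σ : ℝ → Heis n} {a b : ℝ} (hab : a ≤ b)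
    (hσ : IsHorizontal σ a b) : ccDist (σ a) (σ b) ≤ horLength σ a b :=
  iInf_le_of_le a (iInf_le_of_le b (iInf_le_of_le σ (iInf_le _ ⟨hab, hσ, rfl, rfl⟩)))

variable {Ω : Set (Heis n)} {φ : Heis n → ℝ}

/-! ### Weighted length versus line integral -/

theorem sum_lineIntegral (φ : Heis n → ℝ) (σ : ℝ → Heis n) {s : ℕ → ℝ} (hs : Monotone s) (m : ℕ) :
    ∑ i ∈ Finset.range m, lineIntegral φ σ (s i) (s (i + 1)) = lineIntegral φ σ (s 0) (s m) := by
  induction m with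
  | zero => simp [lineIntegral]
  | succ m ih =>
    rw [Finset.sum_range_succ, ih, ← lineIntegral_add φ σ (hs m.zero_le) (hs m.le_succ)]

theorem iInf_mul_ccDist_le_lineIntegral {σ : ℝ → Heis n} {a b : ℝ} (hab : a ≤ b)
    (hσ : IsHorizontal σ a b) {r : ℝ≥0∞} (hr : ∀ s ∈ Icc a b, r ≤ ENNReal.ofReal (φ (σ s))) :
    r * ccDist (σ a) (σ b) ≤ lineIntegral φ σ a b := by
  calc r * ccDist (σ a) (σ b) ≤ r * horLength σ a b := by gcongr; exact hσ.ccDist_le hab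
    _ = ∫⁻ t in Icc a b, r * speed σ t := by
        rw [lintegral_const_mul _ (measurable_speed σ), horLength_eq]
    _ ≤ _ := setLIntegral_mono' measurableSet_Icc fun t ht => by gcongr; exact hr t ht

theorem cost_le_lineIntegral {σ : ℝ → Heis n} {a b : ℝ} (hab : a ≤ b)
    (hσ : IsHorizontal σ a b) (hm : ∀ t ∈ Icc a b, σ t ∈ closure Ω) :
    cost Ω φ (σ a) (σ b) ≤ lineIntegral φ σ a b := by
  have hmono : Monotone fun t => (b - a) * t + a := fun s t hst => by
    have := sub_nonneg.2 hab
    dsimp only; gcongr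
  have hmaps : MapsTo (fun t => (b - a) * t + a) (Icc 0 1) (Icc a b) := fun t ht => by
    have h0 := hmono ht.1
    have h1 := hmono ht.2
    simp only [mul_zero, mul_one] at h0 h1
    exact ⟨by linarith, by linarith⟩
  refine (iInf₂_le (fun t => σ ((b - a) * t + a)) ⟨hσ.comp_affine hab zero_le_one hmaps,
    fun t ht => hm _ (hmaps ht), by simp, by simp⟩).trans ?_
  refine iSup_le fun m => iSup_le fun t => iSup_le fun ⟨ht, ht0, htm⟩ => ?_
  have hs : Monotone fun i => (b - a) * t i + a := hmono.comp ht
  have hmem : ∀ {i}, i ≤ m → (b - a) * t i + a ∈ Icc a b := fun {i} hi =>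
    hmaps ⟨ht0 ▸ ht i.zero_le, htm ▸ ht hi⟩
  refine (Finset.sum_le_sum fun i hi => ?_).trans
    (le_of_eq ((sum_lineIntegral φ σ hs m).trans (by simp [ht0, htm])))
  have hi' : i + 1 ≤ m := Finset.mem_range.1 hi
  refine iInf_mul_ccDist_le_lineIntegral (hs i.le_succ)
    (hσ.mono (hmem (i.le_succ.trans hi')).1 (hs i.le_succ) (hmem hi').2) fun u hu => ?_
  obtain ⟨s, hs, rfl⟩ := intermediate_value_Icc (ht i.le_succ)
    (f := fun t => (b - a) * t + a) (by fun_prop) hu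
  exact iInf₂_le s hs

/-- Writes a uniform partition sum as the integral of a step function, so that Fatou's lemma
applies. -/
theorem setLIntegral_floor (A : ℕ → ℝ≥0∞) (N : ℕ) (hN : 0 < N) :
    ∫⁻ t in Ico (0 : ℝ) 1, A ⌊N * t⌋₊ * N = ∑ i ∈ Finset.range N, A i := by
  have hN' : (0 : ℝ) < N := by exact_mod_cast hN
  have key : ∀ k : ℕ, ∫⁻ t in Ico (0 : ℝ) (k / N), A ⌊N * t⌋₊ * N
      = ∑ i ∈ Finset.range k, A i := by
    intro k
    induction k with
    | zero => simp
    | succ k ih =>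
      have hk : (k : ℝ) / N ≤ ((k + 1 : ℕ) : ℝ) / N := by gcongr; simp
      rw [← Ico_union_Ico_eq_Ico (by positivity) hk, lintegral_union measurableSet_Ico
        (Ico_disjoint_Ico_same), ih, Finset.sum_range_succ]
      congr 1
      rw [setLIntegral_congr_fun (g := fun _ => A k * N) measurableSet_Ico fun t ht => ?_]
      · rw [setLIntegral_const, Real.volume_Ico, mul_assoc, ← sub_div]
        have : (((k + 1 : ℕ) : ℝ) - k) / N = (N : ℝ)⁻¹ := by simp
        rw [this, ENNReal.ofReal_inv_of_pos hN', ENNReal.ofReal_natCast, ENNReal.mul_inv_cancel,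
          mul_one]
        · exact_mod_cast hN.ne'
        · simp
      · have h1 : ⌊N * t⌋₊ = k := by
          rw [Nat.floor_eq_iff (by have := ht.1; have : 0 ≤ t := le_trans (by positivity) this
                                   positivity)]
          have h1 := (div_le_iff₀' hN').1 ht.1
          have h2 := (lt_div_iff₀' hN').1 ht.2
          push_cast at h2
          exact ⟨h1, h2⟩
        simp only [h1]
  rw [← key N, div_self hN'.ne']

theorem norm_sub_ge_of_hasDerivAt {E : Type*} [NormedAddCommGroup E] [NormedSpace ℝ E]
    {f : ℝ → E} {v : E} {t : ℝ} (hf : HasDerivAt f v t) {ε : ℝ} (hε : 0 < ε) :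
    ∃ δ > 0, ∀ a b, t - δ < a → a ≤ t → t ≤ b → b < t + δ →
      (b - a) * (‖v‖ - ε) ≤ ‖f b - f a‖ := by
  have h := hf.isLittleO.def hε
  obtain ⟨δ, hδ, h⟩ := Metric.eventually_nhds_iff.1 h
  refine ⟨δ, hδ, fun a b ha hat htb hb => ?_⟩
  have h1 := h (y := a) (by rw [Real.dist_eq, abs_lt]; constructor <;> linarith)
  have h2 := h (y := b) (by rw [Real.dist_eq, abs_lt]; constructor <;> linarith)
  rw [Real.norm_eq_abs, abs_of_nonpos (by linarith)] at h1
  rw [Real.norm_eq_abs, abs_of_nonneg (by linarith)] at h2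
  have h3 : (b - a) • v = (f b - f a) - (f b - f t - (b - t) • v) + (f a - f t - (a - t) • v) := by
    module
  have h4 : ‖(b - a) • v‖ = (b - a) * ‖v‖ := by
    rw [norm_smul, Real.norm_of_nonneg (by linarith)]
  have h5 := norm_add_le ((f b - f a) - (f b - f t - (b - t) • v)) (f a - f t - (a - t) • v)
  have h6 := norm_sub_le (f b - f a) (f b - f t - (b - t) • v)
  rw [← h3, h4] at h5
  nlinarith

/-- On uniform partitions `d_CC` is bounded below by the Euclidean norm of the horizontal
displacement. The resulting step functions have a pointwise `liminf` at least `φ(σ) |σ'|_H`, and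
Fatou's lemma does the rest. -/
theorem lineIntegral_le_weightedLength {σ : ℝ → Heis n} (hφ : ContinuousOn (φ ∘ σ) (Icc 0 1)) :
    lineIntegral φ σ 0 1 ≤ weightedLength φ σ := by
  set A : ℕ → ℕ → ℝ≥0∞ := fun N i =>
    (⨅ s ∈ Icc ((i : ℝ) / N) ((i + 1 : ℕ) / N), ENNReal.ofReal (φ (σ s))) *
      ENNReal.ofReal ‖hor n (σ ((i + 1 : ℕ) / N) - σ ((i : ℝ) / N))‖ with hA
  have hpt : ∀ t ∈ Ioo (0 : ℝ) 1, ENNReal.ofReal (φ (σ t)) * speed σ t ≤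
      liminf (fun N : ℕ => A (N + 1) ⌊(N + 1 : ℕ) * t⌋₊ * (N + 1 : ℕ)) atTop := by
    intro t ht
    by_cases hd : DifferentiableAt ℝ σ t
    swap
    -- Where `σ` is not differentiable, `deriv` is `0` by convention and the bound is trivial.
    · simp [speed, deriv_zero_of_not_differentiableAt hd, horNorm_eq]
    have hH : HasDerivAt (hor n ∘ σ) (hor n (deriv σ t)) t :=
      (hor n).hasFDerivAt.comp_hasDerivAt t hd.hasDerivAt
    have hc : ContinuousAt (φ ∘ σ) t := hφ.continuousAt (Icc_mem_nhds ht.1 ht.2)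
    -- Continuity of the weight and differentiability of the curve each cost an `ε`, which then
    -- tends to `0`.
    have hε : ∀ ε > 0, ENNReal.ofReal (φ (σ t) - ε) *
        ENNReal.ofReal (‖hor n (deriv σ t)‖ - ε) ≤
        liminf (fun N : ℕ => A (N + 1) ⌊(N + 1 : ℕ) * t⌋₊ * (N + 1 : ℕ)) atTop := by
      intro ε hε
      obtain ⟨δ₁, hδ₁, h1⟩ := norm_sub_ge_of_hasDerivAt hH hε
      obtain ⟨δ₂, hδ₂, h2⟩ := Metric.continuousAt_iff.1 hc ε hε
      refine le_liminf_of_le (by isBoundedDefault) ?_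
      have hlim := (tendsto_one_div_add_atTop_nhds_zero_nat (𝕜 := ℝ)).eventually
        (gt_mem_nhds (lt_min hδ₁ hδ₂))
      filter_upwards [hlim] with N hN
      have hN0 : (0 : ℝ) < (N + 1 : ℕ) := by positivity
      set i := ⌊(N + 1 : ℕ) * t⌋₊ with hi
      have hi1 : (i : ℝ) ≤ (N + 1 : ℕ) * t := Nat.floor_le (mul_nonneg hN0.le ht.1.le)
      have hi2 : (N + 1 : ℕ) * t < i + 1 := Nat.lt_floor_add_one _
      have ha : (i : ℝ) / (N + 1 : ℕ) ≤ t := (div_le_iff₀' hN0).2 hi1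
      have hb : t ≤ (i + 1 : ℕ) / (N + 1 : ℕ) := by
        rw [le_div_iff₀' hN0]; push_cast at hi2 ⊢; exact hi2.le
      have hab : ((i + 1 : ℕ) : ℝ) / (N + 1 : ℕ) - (i : ℝ) / (N + 1 : ℕ) = 1 / (N + 1) := by
        rw [← sub_div]; push_cast; ring
      have hN1 := hN.trans_le (min_le_left _ _)
      have hN2 := hN.trans_le (min_le_right _ _)
      have h3 := h1 _ _ (by linarith) ha hb (by linarith)
      rw [hab] at h3
      have h4 : ENNReal.ofReal (φ (σ t) - ε) ≤
          ⨅ s ∈ Icc ((i : ℝ) / (N + 1 : ℕ)) ((i + 1 : ℕ) / (N + 1 : ℕ)),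
            ENNReal.ofReal (φ (σ s)) := by
        refine le_iInf₂ fun s hs => ENNReal.ofReal_le_ofReal ?_
        have h5 := h2 (x := s) (by
          rw [Real.dist_eq, abs_lt]; constructor <;> linarith [hs.1, hs.2])
        rw [Real.dist_eq, abs_lt] at h5
        simp only [Function.comp_apply] at h5
        linarith [h5.1]
      rw [hA, mul_assoc]
      refine mul_le_mul' h4 ?_
      rw [← ENNReal.ofReal_natCast, ← ENNReal.ofReal_mul (norm_nonneg _)]
      refine ENNReal.ofReal_le_ofReal ?_
      rw [map_sub]
      simp only [Function.comp_apply] at h3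
      rw [one_div, inv_mul_le_iff₀ (by positivity)] at h3
      rw [mul_comm]
      exact_mod_cast h3
    have hlim : Tendsto (fun ε : ℝ => ENNReal.ofReal (φ (σ t) - ε) *
        ENNReal.ofReal (‖hor n (deriv σ t)‖ - ε)) (𝓝[>] 0)
        (𝓝 (ENNReal.ofReal (φ (σ t) - 0) * ENNReal.ofReal (‖hor n (deriv σ t)‖ - 0))) := by
      refine Tendsto.mono_left ?_ nhdsWithin_le_nhds
      refine ENNReal.Tendsto.mul (ENNReal.tendsto_ofReal (Continuous.tendsto (by fun_prop) _))
        (Or.inr ENNReal.ofReal_ne_top)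
        (ENNReal.tendsto_ofReal (Continuous.tendsto (by fun_prop) _))
        (Or.inr ENNReal.ofReal_ne_top)
    rw [sub_zero, sub_zero] at hlim
    rw [speed, horNorm_eq]
    exact le_of_tendsto hlim (eventually_mem_nhdsWithin.mono hε)
  calc lineIntegral φ σ 0 1 = ∫⁻ t in Ioo (0 : ℝ) 1, ENNReal.ofReal (φ (σ t)) * speed σ t := by
        rw [lineIntegral, restrict_Ioo_eq_restrict_Icc]
    _ ≤ ∫⁻ t in Ioo (0 : ℝ) 1,
          liminf (fun N : ℕ => A (N + 1) ⌊(N + 1 : ℕ) * t⌋₊ * (N + 1 : ℕ)) atTop :=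
        setLIntegral_mono' measurableSet_Ioo hpt
    _ ≤ liminf (fun N : ℕ => ∫⁻ t in Ioo (0 : ℝ) 1,
          A (N + 1) ⌊(N + 1 : ℕ) * t⌋₊ * (N + 1 : ℕ)) atTop := by
        refine lintegral_liminf_le fun N => Measurable.mul_const ?_ _
        exact (measurable_from_nat (f := A (N + 1))).comp (Nat.measurable_floor.comp
          (measurable_const_mul ((N + 1 : ℕ) : ℝ)))
    _ ≤ weightedLength φ σ := by
        refine liminf_le_of_le (by isBoundedDefault) fun c hc => ?_
        obtain ⟨N, hN⟩ := hc.exists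
        refine hN.trans ?_
        rw [restrict_Ioo_eq_restrict_Ico, setLIntegral_floor _ _ N.succ_pos]
        refine le_trans ?_ (le_iSup_of_le (N + 1) (le_iSup_of_le (fun i => (i : ℝ) / (N + 1 : ℕ))
          (le_iSup_of_le ⟨fun i j hij => ?_, ?_, ?_⟩ le_rfl)))
        · exact Finset.sum_le_sum fun i _ => mul_le_mul' le_rfl (norm_hor_sub_le_ccDist _ _)
        · dsimp only; gcongr
        · simp
        · exact div_self (by positivity)

theorem cost_eq_iInf_lineIntegral (hφ : ContinuousOn φ (closure Ω)) (x y : Heis n) :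
    cost Ω φ x y = ⨅ σ ∈ curves Ω x y, lineIntegral φ σ 0 1 := by
  refine le_antisymm (le_iInf₂ fun σ hσ => ?_) (iInf₂_mono fun σ hσ => ?_)
  · obtain ⟨h1, h2, rfl, rfl⟩ := hσ
    exact cost_le_lineIntegral zero_le_one h1 h2
  · exact lineIntegral_le_weightedLength (hφ.comp (hσ.1.continuousOn zero_le_one) hσ.2.1)

/-! ### The cost as a pseudo-distance -/

theorem cost_triangle (hφ : ContinuousOn φ (closure Ω)) (x y z : Heis n) :
    cost Ω φ x z ≤ cost Ω φ x y + cost Ω φ y z := by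
  rw [cost_eq_iInf_lineIntegral hφ x y, cost_eq_iInf_lineIntegral hφ y z]
  simp only [ENNReal.iInf_add, ENNReal.add_iInf]
  refine le_iInf₂ fun τ hτ => le_iInf₂ fun σ hσ => ?_
  obtain ⟨hσ1, hσ2, hσx, hσy⟩ := hσ
  obtain ⟨hτ1, hτ2, hτy, hτz⟩ := hτ
  have hm : MapsTo (fun t : ℝ => 1 * t + (-1)) (Icc 1 2) (Icc 0 1) := fun t ht =>
    ⟨by linarith [ht.1], by linarith [ht.2]⟩
  have h1 := hτ1.comp_affine zero_le_one one_le_two hm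
  obtain ⟨ρ, hρ, hρσ, hρτ⟩ := hσ1.glue zero_le_one one_le_two h1 (by simp [hσy, hτy])
  have h2 : lineIntegral φ ρ 0 2 = lineIntegral φ σ 0 1 + lineIntegral φ τ 0 1 := by
    rw [lineIntegral_add φ ρ zero_le_one one_le_two, lineIntegral_congr hρσ,
      lineIntegral_congr hρτ, ← lineIntegral_comp_add_right φ τ 0 1 (-1)]
    norm_num
  have h3 : ρ 0 = x := by rw [hρσ ⟨le_rfl, zero_le_one⟩, hσx]
  have h4 : ρ 2 = z := by rw [hρτ ⟨one_le_two, le_rfl⟩]; norm_num [hτz]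
  have h5 := cost_le_lineIntegral (φ := φ) zero_le_two hρ (Ω := Ω) fun t ht => by
    rcases le_total t 1 with h | h
    · rw [hρσ ⟨ht.1, h⟩]; exact hσ2 t ⟨ht.1, h⟩
    · rw [hρτ ⟨h, ht.2⟩]; exact hτ2 _ (hm ⟨h, ht.2⟩)
  rw [h3, h4, h2] at h5
  exact h5

theorem cost_comm (hφ : ContinuousOn φ (closure Ω)) (x y : Heis n) :
    cost Ω φ x y = cost Ω φ y x := by
  suffices h : ∀ x y, cost Ω φ x y ≤ cost Ω φ y x from le_antisymm (h x y) (h y x)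
  intro x y
  rw [cost_eq_iInf_lineIntegral hφ y x]
  refine le_iInf₂ fun σ ⟨hσ1, hσ2, hσy, hσx⟩ => ?_
  have hm : MapsTo (fun t : ℝ => (-1) * t + 0) (Icc (-1) 0) (Icc 0 1) := fun t ht =>
    ⟨by linarith [ht.2], by linarith [ht.1]⟩
  have h1 := cost_le_lineIntegral (φ := φ) (neg_nonpos.2 zero_le_one)
    (hσ1.comp_affine zero_le_one (neg_nonpos.2 zero_le_one) hm) fun t ht => hσ2 _ (hm ht)
  have h2 := lineIntegral_comp_neg φ σ 0 1
  simp only [neg_mul, one_mul, add_zero, neg_neg, neg_zero, hσx, hσy] at h1 h2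
  exact h1.trans h2.le

/-! ### Left translations -/

/-- The differential of the left translation by `h`. -/
noncomputable def translateDeriv (h : Heis n) : Heis n →L[ℝ] Heis n :=
  LinearMap.toContinuousLinearMap
    { toFun := fun v => (v.1, v.2.1, v.2.2 + (1 / 2) * ∑ j, (h.1 j * v.2.1 j - h.2.1 j * v.1 j))
      map_add' := fun v w => by
        refine Prod.ext rfl (Prod.ext rfl ?_)
        simp only [Prod.snd_add, Prod.fst_add, Pi.add_apply, mul_add, Finset.sum_sub_distrib,
          Finset.sum_add_distrib]
        ring
      map_smul' := fun c v => by
        refine Prod.ext rfl (Prod.ext rfl ?_)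
        simp only [Prod.smul_snd, Prod.smul_fst, Pi.smul_apply, smul_eq_mul, RingHom.id_apply,
          mul_add, Finset.mul_sum]
        congr 1
        exact Finset.sum_congr rfl fun j _ => by ring }

theorem translateDeriv_apply (h v : Heis n) : translateDeriv h v =
    (v.1, v.2.1, v.2.2 + (1 / 2) * ∑ j, (h.1 j * v.2.1 j - h.2.1 j * v.1 j)) := rfl

theorem mul_eq (h q : Heis n) : mul h q = h + translateDeriv h q := by
  refine Prod.ext rfl (Prod.ext rfl ?_)
  simp [mul, translateDeriv_apply, add_assoc]

theorem mul_zero' (h : Heis n) : mul h 0 = h := by rw [mul_eq, map_zero, add_zero]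

theorem zero_mul' (q : Heis n) : mul 0 q = q := by
  simp [mul]

theorem continuous_mul' : Continuous fun z : Heis n × Heis n => mul z.1 z.2 := by
  unfold mul; fun_prop

theorem hasDerivAt_mul {σ : ℝ → Heis n} {v : Heis n} {t : ℝ} (h : Heis n)
    (hσ : HasDerivAt σ v t) : HasDerivAt (fun s => mul h (σ s)) (translateDeriv h v) t := by
  simp only [mul_eq]
  exact ((translateDeriv h).hasFDerivAt.comp_hasDerivAt t hσ).const_add h

theorem horNorm_translateDeriv (h v : Heis n) : horNorm (translateDeriv h v) = horNorm v := rfl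

theorem translateDeriv_mem {q v : Heis n} (h : Heis n) (hv : v ∈ horizontalSpace q) :
    translateDeriv h v ∈ horizontalSpace (mul h q) := by
  rw [mem_horizontalSpace] at hv ⊢
  simp only [translateDeriv_apply, mul, hv, Pi.add_apply, ← mul_add, ← Finset.sum_add_distrib]
  congr 1
  exact Finset.sum_congr rfl fun j _ => by ring

theorem IsHorizontal.mul {σ : ℝ → Heis n} {a b : ℝ} (hab : a ≤ b) (hσ : IsHorizontal σ a b)
    (h : Heis n) : IsHorizontal (fun t => mul h (σ t)) a b := by
  constructor
  · have hL : LipschitzWith ‖translateDeriv h‖₊ (Heis.mul h) :=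
      LipschitzWith.of_dist_le_mul fun p q => by
        simp only [mul_eq, dist_add_left]
        exact (translateDeriv h).lipschitz.dist_le_mul p q
    exact hL.comp_absolutelyContinuousOnInterval hσ.1
  · filter_upwards [hσ.2, hσ.1.ae_differentiableAt' hab] with t h1 h2
    rw [(hasDerivAt_mul h h2.hasDerivAt).deriv]
    exact translateDeriv_mem h h1

theorem IsHorizontal.lineIntegral_mul {σ : ℝ → Heis n} {a b : ℝ} (hab : a ≤ b)
    (hσ : IsHorizontal σ a b) (φ : Heis n → ℝ) (h : Heis n) :
    lineIntegral φ (fun t => Heis.mul h (σ t)) a b =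
      ∫⁻ t in Icc a b, ENNReal.ofReal (φ (Heis.mul h (σ t))) * speed σ t := by
  refine lintegral_congr_ae ?_
  filter_upwards [hσ.1.ae_differentiableAt' hab] with t h2
  rw [speed, (hasDerivAt_mul h h2.hasDerivAt).deriv, horNorm_translateDeriv, ← speed]

/-! ### Finiteness and continuity of the cost -/

theorem lineIntegral_le_mul_horLength {σ : ℝ → Heis n} {a b M : ℝ}
    (h : ∀ t ∈ Icc a b, φ (σ t) ≤ M) :
    lineIntegral φ σ a b ≤ ENNReal.ofReal M * horLength σ a b := by
  rw [horLength_eq, ← lintegral_const_mul _ (measurable_speed σ)]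
  exact setLIntegral_mono' measurableSet_Icc fun t ht => by gcongr; exact h t ht

theorem exists_bound_of_isBounded (hΩb : Bornology.IsBounded Ω)
    (hφ : ContinuousOn φ (closure Ω)) : ∃ M : ℝ, 0 < M ∧ ∀ x ∈ closure Ω, φ x ≤ M := by
  obtain ⟨M, hM⟩ := hΩb.isCompact_closure.exists_bound_of_continuousOn hφ
  exact ⟨max M 1, by positivity, fun x hx =>
    (le_abs_self _).trans ((hM x hx).trans (le_max_left _ _))⟩

/-- The endpoints of a short smooth horizontal curve are close for the cost. -/
theorem eventually_cost_lt_of_family (hΩo : IsOpen Ω) (hΩb : Bornology.IsBounded Ω)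
    (hφ : ContinuousOn φ (closure Ω)) {P : Type*} [TopologicalSpace P] {g : P → Heis n}
    {γ γ' : P → ℝ → Heis n} {p₀ : P} (hg : Continuous g) (hγ : Continuous (Function.uncurry γ))
    (hγ' : Continuous (Function.uncurry γ')) (hd : ∀ p t, HasDerivAt (γ p) (γ' p t) t)
    (hh : ∀ p t, γ' p t ∈ horizontalSpace (γ p t)) (h0 : ∀ t, γ p₀ t = 0) (hp₀ : g p₀ ∈ Ω)
    {ε : ℝ≥0∞} (hε : ε ≠ 0) :
    ∀ᶠ p in 𝓝 p₀, cost Ω φ (mul (g p) (γ p 0)) (mul (g p) (γ p 1)) < ε := by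
  obtain ⟨M, hM0, hM⟩ := exists_bound_of_isBounded hΩb hφ
  obtain ⟨ε', hε'0, hε'⟩ : ∃ ε' : ℝ, 0 < ε' ∧ ENNReal.ofReal ε' < ε := by
    obtain ⟨r, hr0, hr⟩ := ENNReal.lt_iff_exists_nnreal_btwn.1 (pos_iff_ne_zero.2 hε)
    exact ⟨r, by exact_mod_cast hr0, by simpa using hr⟩
  have hγ'0 : ∀ t, γ' p₀ t = 0 := fun t => by
    have h1 := (hd p₀ t).deriv
    rw [show γ p₀ = fun _ => 0 from funext h0, deriv_const] at h1
    exact h1.symm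
  have e1 : ∀ᶠ p in 𝓝 p₀, ∀ t ∈ Icc (0 : ℝ) 1, mul (g p) (γ p t) ∈ Ω := by
    refine isCompact_Icc.eventually_forall_of_forall_eventually fun t _ => ?_
    have hc : Continuous fun z : P × ℝ => mul (g z.1) (γ z.1 z.2) :=
      continuous_mul'.comp ((hg.comp continuous_fst).prodMk hγ)
    refine hc.continuousAt.eventually_mem (hΩo.mem_nhds ?_)
    simpa [h0, mul_zero'] using hp₀
  have e2 : ∀ᶠ p in 𝓝 p₀, ∀ t ∈ Icc (0 : ℝ) 1, horNorm (γ' p t) < ε' / M := by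
    refine isCompact_Icc.eventually_forall_of_forall_eventually fun t _ => ?_
    simp only [horNorm_eq]
    have hc : Continuous fun z : P × ℝ => ‖hor n (γ' z.1 z.2)‖ :=
      ((hor n).continuous.comp hγ').norm
    refine hc.continuousAt.eventually_lt continuousAt_const ?_
    simp only [hγ'0, map_zero, norm_zero]
    positivity
  filter_upwards [e1, e2] with p h1 h2
  have hσ : IsHorizontal (γ p) 0 1 := by
    refine ⟨ContDiffOn.absolutelyContinuousOnInterval (ContDiff.contDiffOn ?_), ae_of_all _ ?_⟩
    · rw [contDiff_one_iff_deriv]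
      refine ⟨fun t => (hd p t).differentiableAt, ?_⟩
      rw [show deriv (γ p) = γ' p from funext fun t => (hd p t).deriv]
      exact hγ'.comp (Continuous.prodMk_right p)
    · intro t; rw [(hd p t).deriv]; exact hh p t
  refine ((cost_le_lineIntegral zero_le_one (hσ.mul zero_le_one (g p))
    fun t ht => subset_closure (h1 t ht)).trans (lineIntegral_le_mul_horLength fun t ht =>
      hM _ (subset_closure (h1 t ht)))).trans_lt (lt_of_le_of_lt ?_ hε')
  calc ENNReal.ofReal M * horLength (fun t => mul (g p) (γ p t)) 0 1
      ≤ ENNReal.ofReal M * ∫⁻ t in Icc (0 : ℝ) 1, ENNReal.ofReal (ε' / M) := by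
        refine mul_le_mul' le_rfl (setLIntegral_mono' measurableSet_Icc fun t ht => ?_)
        rw [(hasDerivAt_mul (g p) (hd p t)).deriv, horNorm_translateDeriv]
        exact ENNReal.ofReal_le_ofReal (h2 t ht).le
    _ = ENNReal.ofReal ε' := by
        rw [setLIntegral_const, Real.volume_Icc, sub_zero, ENNReal.ofReal_one, mul_one,
          ← ENNReal.ofReal_mul hM0.le, mul_div_cancel₀ _ hM0.ne']

/-- A horizontal curve issued from the origin whose endpoint is `(0, 0, r * s)`. -/
noncomputable def loop (j₀ : Fin n) (r s t : ℝ) : Heis n :=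
  (Pi.single j₀ (r * (t - t ^ 2)), Pi.single j₀ (60 * s * (t ^ 2 - t ^ 3)),
    30 * r * s * (t ^ 3 / 3 - t ^ 4 / 2 + t ^ 5 / 5))

/-- The velocity of `loop`. -/
noncomputable def loopDeriv (j₀ : Fin n) (r s t : ℝ) : Heis n :=
  (Pi.single j₀ (r * (1 - 2 * t)), Pi.single j₀ (60 * s * (2 * t - 3 * t ^ 2)),
    30 * r * s * (t ^ 2 - 2 * t ^ 3 + t ^ 4))

theorem hasDerivAt_pi_single (j₀ : Fin n) {f : ℝ → ℝ} {v t : ℝ} (hf : HasDerivAt f v t) :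
    HasDerivAt (fun s => (Pi.single j₀ (f s) : Fin n → ℝ)) (Pi.single j₀ v) t :=
  (ContinuousLinearMap.single ℝ (fun _ : Fin n => ℝ) j₀).hasFDerivAt.comp_hasDerivAt t hf

theorem hasDerivAt_loop (j₀ : Fin n) (r s t : ℝ) :
    HasDerivAt (loop j₀ r s) (loopDeriv j₀ r s t) t := by
  have p1 := hasDerivAt_id t
  have p2 := hasDerivAt_pow 2 t
  have p3 := hasDerivAt_pow 3 t
  have p4 := hasDerivAt_pow 4 t
  have p5 := hasDerivAt_pow 5 t
  refine (hasDerivAt_pi_single j₀ ?_).prodMk ((hasDerivAt_pi_single j₀ ?_).prodMk ?_)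
  · convert! (p1.sub p2).const_mul r using 1
    push_cast; ring
  · convert! (p2.sub p3).const_mul (60 * s) using 1
    push_cast; ring
  · convert! (((p3.div_const 3).sub (p4.div_const 2)).add (p5.div_const 5)).const_mul
      (30 * r * s) using 1
    push_cast; ring

theorem loopDeriv_mem (j₀ : Fin n) (r s t : ℝ) :
    loopDeriv j₀ r s t ∈ horizontalSpace (loop j₀ r s t) := by
  rw [mem_horizontalSpace, Finset.sum_eq_single j₀]
  · simp [loop, loopDeriv]; ring
  · intro j _ hj; simp [loop, loopDeriv, hj]
  · simp

/-- A nearby point `x` is reached in two moves: a horizontal line from `x₀` to the point `m x` with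
the same horizontal coordinates as `x`, then a `loop` correcting the vertical defect `c x`. -/
theorem eventually_cost_lt_of_mem (hn : 1 ≤ n) (hΩo : IsOpen Ω) (hΩb : Bornology.IsBounded Ω)
    (hφ : ContinuousOn φ (closure Ω)) {x₀ : Heis n} (hx₀ : x₀ ∈ Ω) {ε : ℝ≥0∞} (hε : ε ≠ 0) :
    ∀ᶠ x in 𝓝 x₀, cost Ω φ x₀ x < ε := by
  set m : Heis n → Heis n := fun x => mul x₀ (x.1 - x₀.1, x.2.1 - x₀.2.1, 0) with hm
  set c : Heis n → ℝ := fun x => x.2.2 - (m x).2.2 with hc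
  have hmc : Continuous m := continuous_mul'.comp (f := fun x : Heis n =>
    (x₀, ((x.1 - x₀.1, x.2.1 - x₀.2.1, 0) : Heis n))) (by fun_prop)
  have hcc : Continuous c := by fun_prop
  have hm0 : m x₀ = x₀ := by simp only [hm, sub_self]; exact mul_zero' x₀
  have hc0 : c x₀ = 0 := by simp [hc, hm0]
  -- `√` vanishes on negatives, so `r = √|c|` and `s = ±√|c|` with the sign of `c`: a continuous
  -- factorization `c = r s` whose factors both vanish at `x₀`.
  set r : Heis n → ℝ := fun x => √(c x) + √(-c x) with hr
  set s : Heis n → ℝ := fun x => √(c x) - √(-c x) with hs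
  have hrc : Continuous r := by fun_prop
  have hsc : Continuous s := by fun_prop
  have hrs : ∀ x, r x * s x = c x := fun x => by
    simp only [hr, hs]
    rcases le_total 0 (c x) with h | h
    · rw [Real.sqrt_eq_zero_of_nonpos (neg_nonpos.2 h), add_zero, sub_zero, Real.mul_self_sqrt h]
    · rw [Real.sqrt_eq_zero_of_nonpos h, zero_add, zero_sub, mul_neg,
        Real.mul_self_sqrt (neg_nonneg.2 h), neg_neg]
  let j₀ : Fin n := ⟨0, hn⟩
  have hε2 : ε / 2 ≠ 0 := by simpa using hε
  have e1 := eventually_cost_lt_of_family hΩo hΩb hφ (p₀ := x₀) (g := fun _ => x₀)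
    (γ := fun x t => (t • (x.1 - x₀.1), t • (x.2.1 - x₀.2.1), 0))
    (γ' := fun x _ => (x.1 - x₀.1, x.2.1 - x₀.2.1, 0)) continuous_const
    (by unfold Function.uncurry; fun_prop) (by unfold Function.uncurry; fun_prop)
    (fun x t => by
      refine HasDerivAt.prodMk ?_ (HasDerivAt.prodMk ?_ (hasDerivAt_const _ _))
      · simpa using (hasDerivAt_id t).smul_const (x.1 - x₀.1)
      · simpa using (hasDerivAt_id t).smul_const (x.2.1 - x₀.2.1))
    (fun x t => by
      rw [mem_horizontalSpace]
      simp only [Pi.smul_apply, smul_eq_mul, Pi.sub_apply]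
      rw [Finset.sum_eq_zero fun j _ => by ring, mul_zero])
    (fun t => by simp) hx₀ hε2
  have e2 := eventually_cost_lt_of_family hΩo hΩb hφ (p₀ := x₀) (g := m)
    (γ := fun x => loop j₀ (r x) (s x)) (γ' := fun x => loopDeriv j₀ (r x) (s x)) hmc
    (by unfold Function.uncurry loop
        have hp := (ContinuousLinearMap.single ℝ (fun _ : Fin n => ℝ) j₀).continuous
        refine Continuous.prodMk (hp.comp ?_) (Continuous.prodMk (hp.comp ?_) ?_) <;> fun_prop)
    (by unfold Function.uncurry loopDeriv
        have hp := (ContinuousLinearMap.single ℝ (fun _ : Fin n => ℝ) j₀).continuous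
        refine Continuous.prodMk (hp.comp ?_) (Continuous.prodMk (hp.comp ?_) ?_) <;> fun_prop)
    (fun x t => hasDerivAt_loop _ _ _ _) (fun x t => loopDeriv_mem _ _ _ _)
    (fun t => by simp [loop, hr, hs, hc0]) (by rwa [hm0]) hε2
  filter_upwards [e1, e2] with x h1 h2
  have h3 : mul (m x) (loop j₀ (r x) (s x) 0) = m x := by
    rw [show loop j₀ (r x) (s x) 0 = 0 by simp [loop]]; exact mul_zero' _
  have h4 : mul (m x) (loop j₀ (r x) (s x) 1) = x := by
    -- The factor `30` in `loop` compensates `1/3 - 1/2 + 1/5 = 1/30`.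
    have : loop j₀ (r x) (s x) 1 = (0, 0, c x) := by
      rw [← hrs]; simp [loop]; ring
    rw [this]
    simp [hc, mul, hm]
  rw [h3, h4] at h2
  simp only [zero_smul, one_smul] at h1
  rw [show mul x₀ ((0 : Fin n → ℝ), (0 : Fin n → ℝ), (0 : ℝ)) = x₀ from mul_zero' x₀] at h1
  calc cost Ω φ x₀ x ≤ cost Ω φ x₀ (m x) + cost Ω φ (m x) x := cost_triangle hφ _ _ _
    _ < ε / 2 + ε / 2 := ENNReal.add_lt_add h1 h2
    _ = ε := ENNReal.add_halves ε

theorem eventually_cost_lt (hn : 1 ≤ n) (hΩo : IsOpen Ω) (hΩb : Bornology.IsBounded Ω)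
    (hΩa : AccessibleBoundary Ω) (hφ : ContinuousOn φ (closure Ω)) {x₀ : Heis n}
    (hx₀ : x₀ ∈ closure Ω) {ε : ℝ≥0∞} (hε : ε ≠ 0) :
    ∀ᶠ x in 𝓝[closure Ω] x₀, cost Ω φ x₀ x < ε := by
  by_cases h : x₀ ∈ Ω
  · exact (eventually_cost_lt_of_mem hn hΩo hΩb hφ h hε).filter_mono nhdsWithin_le_nhds
  obtain ⟨M, hM0, hM⟩ := exists_bound_of_isBounded hΩb hφ
  obtain ⟨ε', hε'0, hε'⟩ : ∃ ε' : ℝ, 0 < ε' ∧ ENNReal.ofReal ε' < ε := by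
    obtain ⟨r, hr0, hr⟩ := ENNReal.lt_iff_exists_nnreal_btwn.1 (pos_iff_ne_zero.2 hε)
    exact ⟨r, by exact_mod_cast hr0, by simpa using hr⟩
  filter_upwards [hΩa x₀ ⟨hx₀, by rwa [hΩo.interior_eq]⟩ (ε' / M) (by positivity)] with x hx
  obtain ⟨σ, ⟨h1, h2, rfl, rfl⟩, hl⟩ := hx
  refine ((cost_le_lineIntegral zero_le_one h1 h2).trans
    (lineIntegral_le_mul_horLength fun t ht => hM _ (h2 t ht))).trans_lt (lt_of_le_of_lt ?_ hε')
  calc _ ≤ ENNReal.ofReal M * ENNReal.ofReal (ε' / M) := by gcongr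
    _ = _ := by rw [← ENNReal.ofReal_mul hM0.le, mul_div_cancel₀ _ hM0.ne']

/-- Being at finite cost is a symmetric and transitive relation that holds near the diagonal, hence
everywhere on a connected space. -/
theorem cost_lt_top (hn : 1 ≤ n) (hΩo : IsOpen Ω) (hΩb : Bornology.IsBounded Ω)
    (hΩc : IsConnected Ω) (hΩa : AccessibleBoundary Ω) (hφ : ContinuousOn φ (closure Ω))
    (x y : closure Ω) : cost Ω φ x y < ∞ := by
  have : PreconnectedSpace (closure Ω) :=
    isPreconnected_iff_preconnectedSpace.1 hΩc.isPreconnected.closure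
  have : IsTrans (closure Ω) fun x y => cost Ω φ x y < ∞ := ⟨fun x y z hxy hyz =>
    (cost_triangle hφ _ _ _).trans_lt (ENNReal.add_lt_top.2 ⟨hxy, hyz⟩)⟩
  have : Std.Symm fun x y : closure Ω => cost Ω φ x y < ∞ := ⟨fun x y hxy => by
    rwa [cost_comm hφ]⟩
  refine PreconnectedSpace.induction₂ (fun x y : closure Ω => cost Ω φ x y < ∞) (fun x => ?_)
    ‹_› x y
  have h := eventually_cost_lt hn hΩo hΩb hΩa hφ x.2 ENNReal.top_ne_zero
  rwa [nhdsWithin_eq_map_subtype_coe x.2, eventually_map] at h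

theorem continuous_cost (hn : 1 ≤ n) (hΩo : IsOpen Ω) (hΩb : Bornology.IsBounded Ω)
    (hΩc : IsConnected Ω) (hΩa : AccessibleBoundary Ω) (hφ : ContinuousOn φ (closure Ω)) :
    Continuous fun z : closure Ω × closure Ω => cost Ω φ z.1 z.2 := by
  refine continuous_iff_continuousAt.2 fun z₀ => ?_
  refine (ENNReal.tendsto_nhds (cost_lt_top hn hΩo hΩb hΩc hΩa hφ _ _).ne).2 fun ε hε => ?_
  have hε2 : ε / 2 ≠ 0 := by simpa using hε.ne'
  have key : ∀ x : closure Ω, ∀ᶠ y : closure Ω in 𝓝 x, cost Ω φ x y < ε / 2 := fun x => by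
    have h := eventually_cost_lt hn hΩo hΩb hΩa hφ x.2 hε2
    rwa [nhdsWithin_eq_map_subtype_coe x.2, eventually_map] at h
  rw [nhds_prod_eq]
  filter_upwards [(key z₀.1).prod_mk (key z₀.2)] with z ⟨h1, h2⟩
  have four : ∀ a b c d, cost Ω φ a d ≤ cost Ω φ a b + (cost Ω φ b c + cost Ω φ c d) :=
    fun a b c d => (cost_triangle hφ a b d).trans (by gcongr; exact cost_triangle hφ b c d)
  constructor
  · rw [tsub_le_iff_right]
    calc cost Ω φ z₀.1 z₀.2 ≤ _ := four _ z.1 z.2 _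
      _ ≤ ε / 2 + (cost Ω φ z.1 z.2 + ε / 2) := by rw [cost_comm hφ z.2]; gcongr
      _ = cost Ω φ z.1 z.2 + (ε / 2 + ε / 2) := by ring
      _ = _ := by rw [ENNReal.add_halves]
  · calc cost Ω φ z.1 z.2 ≤ _ := four _ z₀.1 z₀.2 _
      _ ≤ ε / 2 + (cost Ω φ z₀.1 z₀.2 + ε / 2) := by rw [cost_comm hφ z.1]; gcongr
      _ = cost Ω φ z₀.1 z₀.2 + (ε / 2 + ε / 2) := by ring
      _ = _ := by rw [ENNReal.add_halves]

/-! ### The constant sequence -/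

theorem cost_le_generalCost (hn : 1 ≤ n) (hΩo : IsOpen Ω) (hΩb : Bornology.IsBounded Ω)
    (hΩc : IsConnected Ω) (hΩa : AccessibleBoundary Ω) (hφ : IsWeight Ω φ) (q : ℝ≥0∞)
    (x y : closure Ω) : cost Ω φ x y ≤ generalCost Ω q φ x y := by
  have hfin := cost_lt_top hn hΩo hΩb hΩc hΩa hφ.1
  have hcont := continuous_cost hn hΩo hΩb hΩc hΩa hφ.1
  let C : C(closure Ω × closure Ω, ℝ≥0) := ⟨fun z => (cost Ω φ z.1 z.2).toNNReal,
    continuous_iff_continuousAt.2 fun z =>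
      (ENNReal.tendsto_toNNReal (hfin z.1 z.2).ne).comp hcont.continuousAt⟩
  have hC : ∀ z, (C z : ℝ≥0∞) = cost Ω φ z.1 z.2 := fun z =>
    ENNReal.coe_toNNReal (hfin z.1 z.2).ne
  rw [← hC (x, y)]
  refine le_iSup₂_of_le C ⟨fun _ => φ, fun _ => hφ, by simp, fun _ => C, fun _ => hC,
    tendsto_const_nhds⟩ le_rfl

/-! ### Averaging over translations and limits of costs -/

/-- Lebesgue measure is invariant under the right translations of the Heisenberg group. -/
theorem lintegral_mul_right {F : Heis n → ℝ≥0∞} (hF : Measurable F) (q : Heis n) :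
    ∫⁻ h, F (mul h q) = ∫⁻ h, F h := by
  have hm : Measurable fun h : Heis n => F (mul h q) :=
    hF.comp (continuous_mul'.comp (Continuous.prodMk_left q)).measurable
  have i1 : ∀ {G : Heis n → ℝ≥0∞}, Measurable G →
      ∫⁻ h, G h = ∫⁻ u : Fin n → ℝ, ∫⁻ v : Fin n → ℝ, ∫⁻ w : ℝ, G (u, v, w) := fun {G} hG => by
    rw [Measure.volume_eq_prod, lintegral_prod _ hG.aemeasurable]
    refine lintegral_congr fun u => ?_
    have hGu : Measurable fun y : (Fin n → ℝ) × ℝ => G (u, y) := hG.comp measurable_prodMk_left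
    rw [Measure.volume_eq_prod, lintegral_prod _ hGu.aemeasurable]
  rw [i1 hm, i1 hF]
  have i2 : ∀ u v : Fin n → ℝ, ∫⁻ w : ℝ, F (mul (u, v, w) q) =
      ∫⁻ w : ℝ, F (u + q.1, v + q.2.1, w) := fun u v => by
    have := lintegral_add_right_eq_self (μ := (volume : Measure ℝ))
      (fun w => F (u + q.1, v + q.2.1, w)) (q.2.2 + (1 / 2) * ∑ j, (u j * q.2.1 j - v j * q.1 j))
    simpa only [mul, add_assoc] using this
  simp only [i2]
  have i3 : ∀ u : Fin n → ℝ, ∫⁻ v : Fin n → ℝ, ∫⁻ w : ℝ, F (u + q.1, v + q.2.1, w) =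
      ∫⁻ v : Fin n → ℝ, ∫⁻ w : ℝ, F (u + q.1, v, w) := fun u =>
    lintegral_add_right_eq_self (fun v : Fin n → ℝ => ∫⁻ w : ℝ, F (u + q.1, v, w)) q.2.1
  simp only [i3]
  exact lintegral_add_right_eq_self
    (fun u : Fin n → ℝ => ∫⁻ v : Fin n → ℝ, ∫⁻ w : ℝ, F (u, v, w)) q.1

/-- Some translate of a curve by an element of `B` has an `F`-weighted length controlled by the
integral of `F`. -/
theorem exists_translate_lintegral_le {F : Heis n → ℝ≥0∞} (hF : Measurable F) {σ : ℝ → Heis n}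
    {a b : ℝ} (hab : a ≤ b) (hσ : ContinuousOn σ (Icc a b)) {B : Set (Heis n)}
    (hB0 : volume B ≠ 0) (hB : volume B ≠ ∞) :
    ∃ h ∈ B, ∫⁻ t in Icc a b, F (mul h (σ t)) * speed σ t ≤
      (∫⁻ q, F q) * (horLength σ a b / volume B) := by
  -- A globally continuous extension of `σ` is needed for joint measurability in `(h, t)`.
  set τ : ℝ → Heis n := IccExtend hab (domRestrict (Icc a b) σ) with hτ
  have hτc : Continuous τ := (continuousOn_iff_continuous_domRestrict.1 hσ).Icc_extend'
  have hτσ : ∀ t ∈ Icc a b, τ t = σ t := fun t ht => by rw [hτ, IccExtend_of_mem _ _ ht]; rfl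
  have hm : Measurable fun z : Heis n × ℝ => F (mul z.1 (τ z.2)) * speed σ z.2 :=
    (hF.comp (continuous_mul'.comp
      (continuous_fst.prodMk (hτc.comp continuous_snd))).measurable).mul
      ((measurable_speed σ).comp measurable_snd)
  obtain ⟨h, hhB, hh⟩ := exists_le_setLAverage (μ := (volume : Measure (Heis n))) hB0 hB
    (f := fun h => ∫⁻ t in Icc a b, F (mul h (τ t)) * speed σ t)
    (Measurable.lintegral_prod_right' hm).aemeasurable
  refine ⟨h, hhB, ?_⟩
  calc ∫⁻ t in Icc a b, F (mul h (σ t)) * speed σ t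
      = ∫⁻ t in Icc a b, F (mul h (τ t)) * speed σ t :=
        setLIntegral_congr_fun measurableSet_Icc fun t ht => by simp only [hτσ t ht]
    _ ≤ (∫⁻ h in B, ∫⁻ t in Icc a b, F (mul h (τ t)) * speed σ t) / volume B := by
        rwa [setLAverage_eq] at hh
    _ ≤ (∫⁻ h, ∫⁻ t in Icc a b, F (mul h (τ t)) * speed σ t) / volume B := by
        gcongr; exact Measure.restrict_le_self
    _ = (∫⁻ t in Icc a b, (∫⁻ q, F q) * speed σ t) / volume B := by
        rw [lintegral_lintegral_swap hm.aemeasurable]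
        congr 1
        refine lintegral_congr fun t => ?_
        have hFt : Measurable fun h => F (mul h (τ t)) :=
          hF.comp (continuous_mul'.comp (Continuous.prodMk_left (τ t))).measurable
        rw [lintegral_mul_const _ hFt, lintegral_mul_right hF]
    _ = _ := by rw [lintegral_const_mul _ (measurable_speed σ), horLength_eq, mul_div_assoc]

theorem coe_le_coe_add_of_dist_lt {a b ε : ℝ≥0} (h : dist a b < ε) :
    (a : ℝ≥0∞) ≤ (b : ℝ≥0∞) + ε := by
  rw [NNReal.dist_eq, abs_lt] at h
  have : (a : ℝ) ≤ b + ε := by linarith [h.2]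
  exact_mod_cast this

/-- A limit of costs is at most the weighted length of a curve that can be pushed inside `Ω` by
small left translations. -/
theorem limit_cost_le_lineIntegral_of_frequently (hΩo : IsOpen Ω) (hΩb : Bornology.IsBounded Ω)
    (hφ : IsWeight Ω φ) {ψ : ℕ → Heis n → ℝ} (hψ : ∀ k, IsWeight Ω (ψ k))
    (hlim : Tendsto (fun k => ∫⁻ q in Ω, ‖ψ k q - φ q‖ₑ) atTop (𝓝 0))
    {C : ℕ → C(closure Ω × closure Ω, ℝ≥0)} {c : C(closure Ω × closure Ω, ℝ≥0)}
    (hC : ∀ k z, (C k z : ℝ≥0∞) = cost Ω (ψ k) z.1 z.2) (hCc : Tendsto C atTop (𝓝 c))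
    {σ : ℝ → Heis n} {a b : ℝ} (hab : a ≤ b) (hσ : IsHorizontal σ a b)
    (hm : ∀ t ∈ Icc a b, σ t ∈ closure Ω)
    (hfreq : ∃ᶠ h in 𝓝 (0 : Heis n), ∀ t ∈ Icc a b, mul h (σ t) ∈ Ω) :
    (c (⟨σ a, hm a ⟨le_rfl, hab⟩⟩, ⟨σ b, hm b ⟨hab, le_rfl⟩⟩) : ℝ≥0∞) ≤
      lineIntegral φ σ a b := by
  have hcomp : CompactSpace (closure Ω) := isCompact_iff_compactSpace.1 hΩb.isCompact_closure
  set z₀ : closure Ω × closure Ω := (⟨σ a, hm a ⟨le_rfl, hab⟩⟩, ⟨σ b, hm b ⟨hab, le_rfl⟩⟩)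
    with hz₀
  have hσc := hσ.continuousOn hab
  have hl : horLength σ a b ≠ ∞ := hσ.horLength_ne_top hab
  refine ENNReal.le_of_forall_pos_le_add fun ε hε _ => ?_
  -- Four errors: moving the endpoints in `c`, replacing `c` by `C k`, the oscillation of `φ` along
  -- the translation, and `ψ k - φ`.
  set e : ℝ≥0 := ε / 4 with he
  have he0 : 0 < e := by positivity
  obtain ⟨η, hη0, hη⟩ : ∃ η : ℝ, 0 < η ∧ ENNReal.ofReal η * horLength σ a b ≤ e := by
    refine ⟨e / ((horLength σ a b).toReal + 1), by positivity, ?_⟩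
    rw [← ENNReal.ofReal_toReal hl, ← ENNReal.ofReal_mul (by positivity),
      ENNReal.ofReal_toReal hl, ← ENNReal.ofReal_coe_nnreal]
    refine ENNReal.ofReal_le_ofReal ?_
    rw [div_mul_eq_mul_div, div_le_iff₀ (by positivity)]
    gcongr
    simp
  obtain ⟨δ₁, hδ₁, h1⟩ := Metric.continuousAt_iff.1 (c.continuous.continuousAt (x := z₀)) e
    (by exact_mod_cast he0)
  obtain ⟨δ₂, hδ₂, h2⟩ := Metric.uniformContinuousOn_iff.1
    (hΩb.isCompact_closure.uniformContinuousOn_of_continuous hφ.1) η hη0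
  set K : Set (Heis n) := σ '' Icc a b with hK
  have hKc : IsCompact K := isCompact_Icc.image_of_continuousOn hσc
  have e1 : ∀ᶠ h in 𝓝 (0 : Heis n), ∀ q ∈ K, dist (mul h q) q < min δ₁ δ₂ := by
    refine hKc.eventually_forall_of_forall_eventually fun q _ => ?_
    refine ContinuousAt.eventually_lt (Continuous.continuousAt
      (continuous_mul'.dist continuous_snd)) continuousAt_const ?_
    simp [zero_mul', hδ₁, hδ₂]
  -- Both requirements on `h`, small displacement and landing in `Ω`, are open, so they persist on a
  -- ball around `h₀`. Its positive volume allows averaging, even if no ball around `0` is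
  -- admissible.
  obtain ⟨h₀, hh₀, e2⟩ := (hfreq.and_eventually e1.eventually_nhds).exists
  have e3 : ∀ᶠ h in 𝓝 h₀, ∀ q ∈ K, mul h q ∈ Ω := by
    refine hKc.eventually_forall_of_forall_eventually fun q hq => ?_
    obtain ⟨t, ht, rfl⟩ := hq
    exact continuous_mul'.continuousAt.eventually_mem (hΩo.mem_nhds (hh₀ t ht))
  obtain ⟨ρ, hρ, hball⟩ := Metric.eventually_nhds_iff_ball.1 (e2.and e3)
  have hB0 : volume (Metric.ball h₀ ρ) ≠ 0 := (Metric.measure_ball_pos volume h₀ hρ).ne'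
  have hB : volume (Metric.ball h₀ ρ) ≠ ∞ := measure_ball_lt_top.ne
  have hlim' : Tendsto (fun k => (∫⁻ q in Ω, ‖ψ k q - φ q‖ₑ) *
      (horLength σ a b / volume (Metric.ball h₀ ρ))) atTop (𝓝 0) := by
    simpa using ENNReal.Tendsto.mul_const hlim (Or.inr (ENNReal.div_ne_top hl hB0))
  obtain ⟨k, hk1, hk2⟩ := ((hlim'.eventually (gt_mem_nhds (show (0 : ℝ≥0∞) < e by
    exact_mod_cast he0))).and (Metric.tendsto_nhds.1 hCc e (by exact_mod_cast he0))).exists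
  set F : Heis n → ℝ≥0∞ := Ω.indicator fun q => ‖ψ k q - φ q‖ₑ with hFdef
  have hF : Measurable F := by
    classical
    rw [hFdef, ← piecewise_eq_indicator]
    exact ContinuousOn.measurable_piecewise
      (((hψ k).1.sub hφ.1).mono subset_closure).enorm continuousOn_const hΩo.measurableSet
  obtain ⟨h, hhB, hh⟩ := exists_translate_lintegral_le hF hab hσc hB0 hB
  rw [hFdef, lintegral_indicator hΩo.measurableSet] at hh
  have hG := hh.trans hk1.le
  rw [← hFdef] at hG
  obtain ⟨hdist, hmem⟩ := hball h hhB
  have hmem' : ∀ t ∈ Icc a b, mul h (σ t) ∈ closure Ω := fun t ht =>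
    subset_closure (hmem _ (mem_image_of_mem σ ht))
  have hdist' : ∀ t ∈ Icc a b, dist (mul h (σ t)) (σ t) < min δ₁ δ₂ := fun t ht =>
    hdist _ (mem_image_of_mem σ ht)
  set z : closure Ω × closure Ω :=
    (⟨mul h (σ a), hmem' a ⟨le_rfl, hab⟩⟩, ⟨mul h (σ b), hmem' b ⟨hab, le_rfl⟩⟩) with hz
  have hzz : dist z z₀ < δ₁ := by
    rw [Prod.dist_eq, max_lt_iff]
    exact ⟨(hdist' a ⟨le_rfl, hab⟩).trans_le (min_le_left _ _),
      (hdist' b ⟨hab, le_rfl⟩).trans_le (min_le_left _ _)⟩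
  have s1 : (c z₀ : ℝ≥0∞) ≤ c z + e := coe_le_coe_add_of_dist_lt (by
    rw [dist_comm]; exact h1 hzz)
  have s2 : (c z : ℝ≥0∞) ≤ C k z + e := coe_le_coe_add_of_dist_lt (by
    rw [dist_comm]; exact (ContinuousMap.dist_apply_le_dist z).trans_lt hk2)
  have s3 : (C k z : ℝ≥0∞) ≤ lineIntegral φ σ a b + e + e := by
    rw [hC]
    refine (cost_le_lineIntegral hab (hσ.mul hab h) hmem').trans ?_
    rw [hσ.lineIntegral_mul hab]
    have hFm : AEMeasurable (fun t => F (mul h (σ t)) * speed σ t)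
        (volume.restrict (Icc a b)) := by
      refine AEMeasurable.mul ?_ (measurable_speed σ).aemeasurable
      exact (hF.comp (continuous_mul'.comp (Continuous.prodMk_right h)).measurable).comp_aemeasurable
        (hσc.aemeasurable measurableSet_Icc)
    calc ∫⁻ t in Icc a b, ENNReal.ofReal (ψ k (mul h (σ t))) * speed σ t
        ≤ ∫⁻ t in Icc a b, (ENNReal.ofReal (φ (σ t)) * speed σ t +
            ENNReal.ofReal η * speed σ t) + F (mul h (σ t)) * speed σ t := by
          refine setLIntegral_mono' measurableSet_Icc fun t ht => ?_
          rw [← add_mul, ← add_mul]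
          gcongr
          have hΩt : mul h (σ t) ∈ Ω := hmem _ (mem_image_of_mem σ ht)
          rw [hFdef, indicator_of_mem hΩt, ← ofReal_norm,
            ← ENNReal.ofReal_add (hφ.2 _ (hm t ht)) hη0.le,
            ← ENNReal.ofReal_add (add_nonneg (hφ.2 _ (hm t ht)) hη0.le) (norm_nonneg _)]
          refine ENNReal.ofReal_le_ofReal ?_
          have h3 := h2 _ (hmem' t ht) _ (hm t ht) ((hdist' t ht).trans_le (min_le_right _ _))
          rw [Real.dist_eq, abs_lt] at h3
          have h4 := le_abs_self (ψ k (mul h (σ t)) - φ (mul h (σ t)))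
          rw [Real.norm_eq_abs]
          linarith [h3.2]
      _ = lineIntegral φ σ a b + ENNReal.ofReal η * horLength σ a b +
            ∫⁻ t in Icc a b, F (mul h (σ t)) * speed σ t := by
          rw [lintegral_add_right' _ hFm,
            lintegral_add_right _ ((measurable_speed σ).const_mul _),
            lintegral_const_mul _ (measurable_speed σ)]
          rfl
      _ ≤ _ := by gcongr
  calc (c z₀ : ℝ≥0∞) ≤ lineIntegral φ σ a b + e + e + e + e :=
        s1.trans (by gcongr; exact s2.trans (by gcongr))
    _ = lineIntegral φ σ a b + ((e + e + e + e : ℝ≥0) : ℝ≥0∞) := by push_cast; ring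
    _ = _ := by congr 2; rw [he]; field_simp; norm_num

/-- A good translation exists only locally, so the curve is cut into finitely many pieces, each in
one good neighbourhood and each with its own translations. The limit `c` inherits the triangle
inequality from the `C k`. -/
theorem limit_cost_le_lineIntegral (hΩo : IsOpen Ω) (hΩb : Bornology.IsBounded Ω)
    (hΩt : InwardTranslations Ω)
    (hφ : IsWeight Ω φ) {ψ : ℕ → Heis n → ℝ} (hψ : ∀ k, IsWeight Ω (ψ k))
    (hlim : Tendsto (fun k => ∫⁻ q in Ω, ‖ψ k q - φ q‖ₑ) atTop (𝓝 0))
    {C : ℕ → C(closure Ω × closure Ω, ℝ≥0)} {c : C(closure Ω × closure Ω, ℝ≥0)}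
    (hC : ∀ k z, (C k z : ℝ≥0∞) = cost Ω (ψ k) z.1 z.2) (hCc : Tendsto C atTop (𝓝 c))
    {σ : ℝ → Heis n} {a b : ℝ} (hab : a ≤ b) (hσ : IsHorizontal σ a b)
    (hm : ∀ t ∈ Icc a b, σ t ∈ closure Ω) :
    (c (⟨σ a, hm a ⟨le_rfl, hab⟩⟩, ⟨σ b, hm b ⟨hab, le_rfl⟩⟩) : ℝ≥0∞) ≤
      lineIntegral φ σ a b := by
  have hcomp : CompactSpace (closure Ω) := isCompact_iff_compactSpace.1 hΩb.isCompact_closure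
  have hpt : ∀ z, Tendsto (fun k => (C k z : ℝ≥0∞)) atTop (𝓝 (c z)) := fun z =>
    ENNReal.tendsto_coe.2 ((ContinuousMap.tendsto_iff_tendstoUniformly.1 hCc).tendsto_at z)
  have htri : ∀ x y z, (c (x, z) : ℝ≥0∞) ≤ c (x, y) + c (y, z) := fun x y z =>
    le_of_tendsto_of_tendsto' (hpt _) ((hpt _).add (hpt _)) fun k => by
      simp only [hC]; exact cost_triangle (hψ k).1 _ _ _
  have hloc : ∀ z ∈ closure Ω, ∃ U ∈ 𝓝 z,
      ∃ᶠ h in 𝓝 (0 : Heis n), ∀ q ∈ U ∩ closure Ω, mul h q ∈ Ω := fun z hz => by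
    by_cases h : z ∈ Ω
    · refine ⟨Ω, hΩo.mem_nhds h, fun hne => ?_⟩
      -- At an interior point `h = 0` itself is admissible.
      exact hne.self_of_nhds fun q hq => by rw [zero_mul']; exact hq.1
    · exact hΩt z ⟨hz, by rwa [hΩo.interior_eq]⟩
  choose! U hU hUf using hloc
  have hσc := continuousOn_iff_continuous_domRestrict.1 (hσ.continuousOn hab)
  obtain ⟨t, ht0, htm, ⟨m, hm1⟩, hcov⟩ := exists_monotone_Icc_subset_open_cover_Icc hab
    (c := fun i : Icc a b => domRestrict (Icc a b) σ ⁻¹' interior (U (σ i)))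
    (fun i => isOpen_interior.preimage hσc)
    (fun s _ => mem_iUnion.2 ⟨s, mem_interior_iff_mem_nhds.2 (hU _ (hm s s.2))⟩)
  have piece : ∀ i (u v : Icc a b), t i ≤ u → (huv : u ≤ v) → v ≤ t (i + 1) →
      (c (⟨σ u, hm u u.2⟩, ⟨σ v, hm v v.2⟩) : ℝ≥0∞) ≤ lineIntegral φ σ u v := by
    intro i u v hu huv hv
    obtain ⟨j, hj⟩ := hcov i
    refine limit_cost_le_lineIntegral_of_frequently hΩo hΩb hφ hψ hlim hC hCc huv
      (hσ.mono u.2.1 huv v.2.2) (fun s hs => hm s ⟨u.2.1.trans hs.1, hs.2.trans v.2.2⟩)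
      ((hUf _ (hm j j.2)).mono fun h hh s hs => ?_)
    have hs' : s ∈ Icc a b := ⟨u.2.1.trans hs.1, hs.2.trans v.2.2⟩
    exact hh _ ⟨interior_subset (hj (a := ⟨s, hs'⟩) ⟨le_trans hu hs.1, le_trans hs.2 hv⟩), hm s hs'⟩
  have key : ∀ i, (c (⟨σ (t 0), hm _ (t 0).2⟩, ⟨σ (t i), hm _ (t i).2⟩) : ℝ≥0∞) ≤
      lineIntegral φ σ (t 0) (t i) := by
    intro i
    induction i with
    | zero => exact piece 0 _ _ le_rfl le_rfl (htm (Nat.zero_le _))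
    | succ i ih =>
      rw [lineIntegral_add φ σ (htm i.zero_le) (htm i.le_succ)]
      exact (htri _ ⟨σ (t i), hm _ (t i).2⟩ _).trans
        (add_le_add ih (piece i _ _ le_rfl (htm i.le_succ) le_rfl))
  have := key m
  simp only [ht0, hm1 m le_rfl] at this
  exact this

/-! ### From `L^q` to `L^1` convergence, and conclusion -/

theorem tendsto_lintegral_enorm_of_tendsto_eLpNorm {α E : Type*} [MeasurableSpace α]
    [NormedAddCommGroup E] {μ : Measure α} [IsFiniteMeasure μ] {f : ℕ → α → E} {q : ℝ≥0∞}
    (hq : 1 ≤ q) (hf : ∀ k, AEStronglyMeasurable (f k) μ)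
    (h : Tendsto (fun k => eLpNorm (f k) q μ) atTop (𝓝 0)) :
    Tendsto (fun k => ∫⁻ x, ‖f k x‖ₑ ∂μ) atTop (𝓝 0) := by
  have hle : (0 : ℝ) ≤ 1 / (1 : ℝ≥0∞).toReal - 1 / q.toReal := by
    rcases eq_or_ne q ∞ with rfl | hq'
    · simp
    · have : 1 ≤ q.toReal := by simpa using ENNReal.toReal_mono hq' hq
      simp only [ENNReal.toReal_one, div_one, sub_nonneg, one_div]
      exact inv_le_one_of_one_le₀ this
  have h' := ENNReal.Tendsto.mul_const (b := μ univ ^ (1 / (1 : ℝ≥0∞).toReal - 1 / q.toReal)) h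
    (Or.inr (ENNReal.rpow_ne_top_of_nonneg hle (measure_ne_top μ _)))
  rw [zero_mul] at h'
  refine tendsto_of_tendsto_of_tendsto_of_le_of_le tendsto_const_nhds h' (fun _ => zero_le)
    fun k => ?_
  simp only [← eLpNorm_one_eq_lintegral_enorm]
  exact eLpNorm_le_eLpNorm_mul_rpow_measure_univ hq (hf k)

theorem generalCost_le_cost (hΩo : IsOpen Ω) (hΩb : Bornology.IsBounded Ω)
    (hΩt : InwardTranslations Ω) (hφ : IsWeight Ω φ) {q : ℝ≥0∞} (hq : 1 ≤ q)
    (x y : closure Ω) : generalCost Ω q φ x y ≤ cost Ω φ x y := by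
  refine iSup₂_le fun c ⟨ψ, hψ, hlim, C, hC, hCc⟩ => ?_
  have : IsFiniteMeasure (volume.restrict Ω) := ⟨by simpa using hΩb.measure_lt_top⟩
  have hlim1 := tendsto_lintegral_enorm_of_tendsto_eLpNorm hq (fun k =>
    (((hψ k).1.sub hφ.1).mono subset_closure).aestronglyMeasurable hΩo.measurableSet) hlim
  rw [cost_eq_iInf_lineIntegral hφ.1]
  refine le_iInf₂ fun σ ⟨h1, h2, hx, hy⟩ => ?_
  have := limit_cost_le_lineIntegral hΩo hΩb hΩt hφ hψ hlim1 hC hCc zero_le_one h1 h2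
  simpa only [hx, hy] using this

end Heis

theorem mainTheorem9 (n : ℕ) (hn : 1 ≤ n) (Ω : Set (Heis n))
    (hΩo : IsOpen Ω) (hΩb : Bornology.IsBounded Ω) (hΩc : IsConnected Ω)
    (hΩa : Heis.AccessibleBoundary Ω) (hΩt : Heis.InwardTranslations Ω)
    (p : ℝ) (hp : 1 < p) (hpN : p < (2 * (n : ℝ) + 2) / (2 * (n : ℝ) + 1))
    (φ : Heis n → ℝ) (hφ : Heis.IsWeight Ω φ) (x y : closure Ω) :
    Heis.cost Ω φ x y = Heis.generalCost Ω (ENNReal.ofReal (p / (p - 1))) φ x y := by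
  refine le_antisymm (Heis.cost_le_generalCost hn hΩo hΩb hΩc hΩa hφ _ x y)
    (Heis.generalCost_le_cost hΩo hΩb hΩt hφ ?_ x y)
  rw [ENNReal.one_le_ofReal, one_le_div (by linarith)]
  linarith
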